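/- Let $g\ge 0$ be an integer and let $n=2g+1$. Let $A_0$ be the $n\times n$ symmetric matrix with $1$'s on the anti-diagonal and $0$'s elsewhere, and let $W(\mathbb{Q})$ be the space of symmetric $n\times n$ matrices over $\mathbb{Q}$. For $B_0\in W(\mathbb{Q})$ let $\Delta(B_0)$ denote the discriminant of the monic polynomial $(-1)^{n(n-1)/2}\det(xA_0-B_0)\in\mathbb{Q}[x]$. Call $B_0\in W(\mathbb{Q})$ distinguished if $\Delta(B_0)\neq 0$ and there is a $g$-dimensional subspace $Y\subseteq\mathbb{Q}^n$ such that $v^tA_0v=v^tB_0v=0$ for all $v\in Y$. Let $b_{ij}$ ($1\le i\le j\le n$) be independent indeterminates, the entries of the generic symmetric $n\times n$ matrix $B$. Then there exists a polynomial $F(B,x)\in\mathbb{Z}[\sqrt{-1}][b_{ij} : i\le j][x]$ of degree $2^{2g}$ in $x$ that is irreducible in $\mathbb{Q}(\sqrt{-1})(b_{ij} : i\le j)[x]$ and such that, for every distinguished $B_0\in W(\mathbb{Q})$, the polynomial $F(B_0,x)\in\mathbb{Q}(\sqrt{-1})[x]$ obtained by substituting the entries of $B_0$ for the $b_{ij}$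 has a root in $\mathbb{Q}$. -/

import Mathlib

open scoped Matrix

/-- The field `ℚ(√-1)`, as the fraction field of the ring `ℤ[√-1]` of Gaussian integers. -/
abbrev GaussianRat : Type := FractionRing GaussianInt

/-- The symmetric `n × n` matrix `A₀` over `ℚ` with `1`'s on the anti-diagonal and `0`'s
elsewhere. -/
def antidiagMatrix (n : ℕ) : Matrix (Fin n) (Fin n) ℚ :=
  Matrix.of fun i j => if j = Fin.rev i then 1 else 0

/-- The monic resolvent polynomial `(-1)^(n(n-1)/2) det(x A₀ - B)` of `B`. -/
noncomputable def resolventPoly {n : ℕ} (B : Matrix (Fin n) (Fin n) ℚ) : Polynomial ℚ :=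
  (-1) ^ (n * (n - 1) / 2) *
    ((Polynomial.X : Polynomial ℚ) • (antidiagMatrix n).map Polynomial.C
      - B.map Polynomial.C).det

/-- The discriminant `Δ(B)`: the discriminant of the resolvent polynomial of `B`. -/
noncomputable def matDisc {n : ℕ} (B : Matrix (Fin n) (Fin n) ℚ) : ℚ :=
  (resolventPoly B).discr

/-- The subspace `Y` of `ℚⁿ` is (totally) isotropic with respect to the quadratic form
`v ↦ vᵗ M v` defined by the symmetric matrix `M`. -/
def IsIsotropicFor {n : ℕ} (M : Matrix (Fin n) (Fin n) ℚ) (Y : Submodule ℚ (Fin n → ℚ)) : Prop :=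
  ∀ v ∈ Y, v ⬝ᵥ (M *ᵥ v) = 0

/-- A rational symmetric matrix `B` of odd size `2g + 1` is distinguished if `Δ(B) ≠ 0` and there
is a `g`-dimensional subspace of `ℚ^(2g+1)` that is isotropic for both `A₀` and `B`. -/
def IsDistinguished {g : ℕ} (B : Matrix (Fin (2 * g + 1)) (Fin (2 * g + 1)) ℚ) : Prop :=
  B.IsSymm ∧ matDisc B ≠ 0 ∧
    ∃ Y : Submodule ℚ (Fin (2 * g + 1) → ℚ), Module.finrank ℚ Y = g ∧
      IsIsotropicFor (antidiagMatrix (2 * g + 1)) Y ∧ IsIsotropicFor B Y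

/-- The index set of the independent entries `b_ij`, `i ≤ j`, of a symmetric `n × n` matrix. -/
abbrev SymIndex (n : ℕ) : Type := {p : Fin n × Fin n // p.1 ≤ p.2}

/-- The polynomial ring `ℤ[√-1][b_ij : i ≤ j]` in the entries of the generic symmetric matrix. -/
abbrev EntryRing (n : ℕ) : Type := MvPolynomial (SymIndex n) GaussianInt

/-- The rational function field `ℚ(√-1)(b_ij : i ≤ j)`. -/
abbrev EntryField (n : ℕ) : Type := FractionRing (MvPolynomial (SymIndex n) GaussianRat)

/-- The natural embedding `ℤ[√-1][b_ij] → ℚ(√-1)(b_ij)`. -/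
noncomputable def entryRingToField (n : ℕ) : EntryRing n →+* EntryField n :=
  (algebraMap (MvPolynomial (SymIndex n) GaussianRat) (EntryField n)).comp
    (MvPolynomial.map (algebraMap GaussianInt GaussianRat))

/-- The specialization `F(B₀, x) ∈ ℚ(√-1)[x]` of `F(B, x) ∈ ℤ[√-1][b_ij][x]`, substituting the
entries of the rational symmetric matrix `B₀` for the indeterminates `b_ij`. -/
noncomputable def specializeAt {n : ℕ} (F : Polynomial (EntryRing n))
    (B₀ : Matrix (Fin n) (Fin n) ℚ) : Polynomial GaussianRat :=
  F.map (MvPolynomial.eval₂Hom (algebraMap GaussianInt GaussianRat)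
    fun p : SymIndex n => ((B₀ p.1.1 p.1.2 : ℚ) : GaussianRat))

/-!
Write `T = A₀ B`, which is self-adjoint for the form `A₀`, let `f` be its characteristic
polynomial and `l₁, …, lₙ` its eigenvalues. For a fixed vector `w`, here the all-ones vector, put
`βᵢ = wᵗ A₀ qᵢ(T) w` with `qᵢ = f / (X - lᵢ)`: this is `f'(lᵢ)` times the norm of the
`lᵢ`-component of `w`, and a polynomial in `lᵢ` (`componentPoly`). For generic `B` the common
isotropic subspaces of dimension `g` correspond to the choices of all `√βᵢ` up to a common sign,
so `F` is taken to be `∏ (x - (∑ ± √βᵢ)²)` over the `2 ^ (2g)` sign patterns modulo a common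
sign, that is, as `n` is odd, over those with product `1`. Its coefficients are even and symmetric
in the `√βᵢ`, hence integral polynomials in the coefficients of the characteristic polynomial of
the matrix `β(T)`, which has the eigenvalues `βᵢ` (`exists_universal_signProd`,
`pencilResolvent`). In particular `F` is monic and compatible with every change of ring.

*Rational roots.* If `Y` is isotropic for both forms, a dimension count yields `y ∈ Y` with
`y, T y, …, T ^ (g - 1) y ∈ Y`, so the moments `yᵗ A₀ T ^ k y` vanish for `k < 2g`. The moment `κ`
for `k = 2g` is nonzero as `T` has distinct eigenvalues (`eq_zero_of_moments_eq_zero`). Hence `y`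
is cyclic, `w = h(T) y` with `h` rational, and `βᵢ = κ h(lᵢ)²`, because `qᵢ` is monic of degree
`2g`. Then `(∑ √βᵢ)² = κ (tr h(T))²` is rational (`IsDistinguished.exists_root_pencilResolvent`).

*Irreducibility.* As `F` is monic, it suffices to find one specialization with irreducible `F`.
Over a field containing `I = √-1` the matrix `A₀` has the symmetric square root
`(1 + I A₀) / (1 + I)`, so there is a `B` with constant orthonormal eigenbasis and prescribed
eigenvalues, and for it `βᵢ = f'(lᵢ)`. With the eigenvalues `0, …, 2g - 1, t` over `ℚ(√-1)(t)` no
nonempty product of `βᵢ` that omits the last one is a square, but the product of all `βᵢ` is one.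
By Kummer theory (`exists_algEquiv_sign`) all sign patterns with product `1` are realised by Galois
automorphisms; so the `√βᵢ` are linearly independent, and `(∑ √βᵢ)²` has `2 ^ (2g)` distinct
conjugates (`irreducible_of_map_eq_signProd`).
-/

/-! ### Sign patterns and even symmetric polynomials -/

/-- The sign `±1` attached to a class modulo `2`. -/
def zmodSign (a : ZMod 2) : ℤ := if a = 0 then 1 else -1

lemma zmodSign_add (a b : ZMod 2) : zmodSign (a + b) = zmodSign a * zmodSign b := by
  revert a b; decide

@[simp] lemma zmodSign_zero : zmodSign 0 = 1 := rfl

@[simp] lemma zmodSign_one : zmodSign 1 = -1 := rfl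

lemma zmodSign_injective : Function.Injective zmodSign := by
  unfold Function.Injective; decide

lemma zmodSign_eq_one_or (a : ZMod 2) : zmodSign a = 1 ∨ zmodSign a = -1 := by
  revert a; decide

lemma zmodSign_sum {ι : Type*} (s : Finset ι) (v : ι → ZMod 2) :
    zmodSign (∑ i ∈ s, v i) = ∏ i ∈ s, zmodSign (v i) := by
  classical
  induction s using Finset.induction_on with
  | empty => simp
  | insert a s ha ih => rw [Finset.sum_insert ha, Finset.prod_insert ha, zmodSign_add, ih]

/-- The sign patterns with product `1`. For odd `n` they represent the sign patterns
modulo a global change of sign. -/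
def evenPatterns (n : ℕ) : Finset (Fin n → ZMod 2) :=
  Finset.univ.filter fun v => ∑ i, v i = 0

lemma mem_evenPatterns {n : ℕ} {v : Fin n → ZMod 2} :
    v ∈ evenPatterns n ↔ ∑ i, v i = 0 := by
  simp [evenPatterns]

lemma card_evenPatterns (m : ℕ) : (evenPatterns (m + 1)).card = 2 ^ m := by
  have : (Finset.univ : Finset (Fin m → ZMod 2)).card = 2 ^ m := by
    simp [ZMod.card]
  rw [← this]
  symm
  refine Finset.card_bij' (fun u _ => Fin.snoc (α := fun _ => ZMod 2) u (∑ i, u i))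
    (fun v _ => Fin.init (α := fun _ => ZMod 2) v) ?_ ?_ ?_ ?_
  · intro u _
    rw [mem_evenPatterns, Fin.sum_univ_castSucc]
    simp [CharTwo.add_self_eq_zero]
  · simp
  · intro u _
    simp
  · intro v hv
    rw [mem_evenPatterns, Fin.sum_univ_castSucc] at hv
    have hl : ∑ i : Fin m, Fin.init (α := fun _ => ZMod 2) v i = v (Fin.last m) := by
      rw [CharTwo.add_eq_zero] at hv
      exact hv
    rw [hl, Fin.snoc_init_self]

/-- The polynomial `∏ (X - (∑ ± rᵢ)²)` over the sign patterns with product `1`. -/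
noncomputable def signProd {n : ℕ} {R : Type*} [CommRing R] (r : Fin n → R) : Polynomial R :=
  ∏ v ∈ evenPatterns n, (Polynomial.X - Polynomial.C ((∑ i, (zmodSign (v i) : R) * r i) ^ 2))

lemma signProd_monic {n : ℕ} {R : Type*} [CommRing R] (r : Fin n → R) : (signProd r).Monic :=
  Polynomial.monic_prod_of_monic _ _ fun _ _ => Polynomial.monic_X_sub_C _

lemma signProd_natDegree {m : ℕ} {R : Type*} [CommRing R] [Nontrivial R] (r : Fin (m + 1) → R) :
    (signProd r).natDegree = 2 ^ m := by
  rw [signProd, Polynomial.natDegree_prod_of_monic _ _ fun _ _ => Polynomial.monic_X_sub_C _]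
  simp only [Polynomial.natDegree_X_sub_C, Finset.sum_const, card_evenPatterns, smul_eq_mul,
    mul_one]

lemma signProd_map {n : ℕ} {R S : Type*} [CommRing R] [CommRing S] (φ : R →+* S) (r : Fin n → R) :
    (signProd r).map φ = signProd fun i => φ (r i) := by
  rw [signProd, Polynomial.map_prod]
  refine Finset.prod_congr rfl fun v _ => ?_
  rw [Polynomial.map_sub, Polynomial.map_X, Polynomial.map_C, map_pow, map_sum]
  simp only [map_mul, map_intCast]

lemma signProd_perm {n : ℕ} {R : Type*} [CommRing R] (r : Fin n → R) (e : Equiv.Perm (Fin n)) :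
    signProd (fun i => r (e i)) = signProd r := by
  unfold signProd
  refine Finset.prod_bij' (fun v _ => v ∘ e.symm) (fun v _ => v ∘ e) ?_ ?_ ?_ ?_ ?_
  · intro v hv
    rw [mem_evenPatterns] at *
    rw [← hv]
    exact Equiv.sum_comp e.symm v
  · intro v hv
    rw [mem_evenPatterns] at *
    rw [← hv]
    exact Equiv.sum_comp e v
  · intro v _; ext; simp
  · intro v _; ext; simp
  · intro v _
    congr 3
    refine (Equiv.sum_comp e.symm _).symm.trans ?_
    simp

/-- Changing the sign of one `rᵢ` permutes the factors of `signProd r`: the new pattern is made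
even again by a global change of sign, which the square does not see. -/
lemma signProd_neg {n : ℕ} (hn : Odd n) {R : Type*} [CommRing R] (r : Fin n → R) (k : Fin n) :
    signProd (fun i => if i = k then -r i else r i) = signProd r := by
  unfold signProd
  set t : Fin n → ZMod 2 := fun i => if i = k then 0 else 1 with ht
  have htsum : ∑ i, t i = 0 := by
    have h1 : ∀ i, t i = 1 + if i = k then 1 else 0 := by
      intro i
      simp only [ht]
      split_ifs <;> decide
    obtain ⟨m, rfl⟩ := hn
    simp only [h1, Finset.sum_add_distrib]
    simp only [Finset.sum_const, Finset.card_univ, Fintype.card_fin, Finset.sum_ite_eq',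
      Finset.mem_univ, if_true, nsmul_eq_mul, mul_one]
    push_cast
    rw [show (2 : ZMod 2) = 0 from rfl, zero_mul, zero_add]
    decide
  have htt : ∀ v : Fin n → ZMod 2, v + t + t = v := by
    intro v
    ext i
    simp [add_assoc, CharTwo.add_self_eq_zero]
  have hmem : ∀ v ∈ evenPatterns n, v + t ∈ evenPatterns n := by
    intro v hv
    rw [mem_evenPatterns] at *
    simp [Finset.sum_add_distrib, hv, htsum]
  refine Finset.prod_bij' (fun v _ => v + t) (fun v _ => v + t) hmem hmem
    (fun v _ => htt v) (fun v _ => htt v) ?_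
  intro v _
  congr 2
  rw [← neg_sq, ← Finset.sum_neg_distrib]
  congr 1
  refine Finset.sum_congr rfl fun i _ => ?_
  rw [Pi.add_apply, zmodSign_add]
  simp only [ht]
  split_ifs <;> simp

open MvPolynomial in
lemma MvPolynomial.coeff_aeval_neg {σ : Type*} [DecidableEq σ] (k : σ) (p : MvPolynomial σ ℤ)
    (m : σ →₀ ℕ) :
    coeff m (aeval (fun i => if i = k then -X i else X i : σ → MvPolynomial σ ℤ) p) =
      (-1) ^ m k * coeff m p := by
  induction p using MvPolynomial.induction_on' with
  | monomial u a =>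
    have : aeval (fun i => if i = k then -X i else X i : σ → MvPolynomial σ ℤ) (monomial u a)
        = (-1) ^ u k * monomial u a := by
      rw [aeval_monomial, monomial_eq]
      have h : ∀ i, (if i = k then -X i else X i : MvPolynomial σ ℤ) ^ u i
          = (if i = k then (-1) ^ u i else 1) * X i ^ u i := by
        intro i
        split_ifs
        · rw [neg_pow]
        · rw [one_mul]
      simp only [Finsupp.prod, h, Finset.prod_mul_distrib]
      rw [Finset.prod_ite_eq']
      split_ifs with hk
      · rw [algebraMap_eq]; ring
      · rw [Finsupp.notMem_support_iff.mp hk, algebraMap_eq]; ring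
    rw [this]
    have h2 : ((-1) ^ u k * monomial u a : MvPolynomial σ ℤ) = C ((-1) ^ u k) * monomial u a := by
      simp
    rw [h2, coeff_C_mul, coeff_monomial]
    split_ifs with h
    · rw [h]
    · simp
  | add p q hp hq => rw [map_add, coeff_add, coeff_add, hp, hq]; ring

open MvPolynomial in
/-- A polynomial which is even in each variable is a polynomial in the squares. -/
lemma MvPolynomial.mem_range_expand_two {σ : Type*} [DecidableEq σ] (p : MvPolynomial σ ℤ)
    (hp : ∀ k, aeval (fun i => if i = k then -X i else X i : σ → MvPolynomial σ ℤ) p = p) :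
    p ∈ (expand 2 : MvPolynomial σ ℤ →ₐ[ℤ] MvPolynomial σ ℤ).range := by
  rw [p.as_sum]
  refine Subalgebra.sum_mem _ fun m hm => ?_
  have heven : ∀ k, 2 ∣ m k := by
    intro k
    by_contra hk
    have h := coeff_aeval_neg k p m
    rw [hp k, Odd.neg_one_pow (Nat.odd_iff.mpr (by omega))] at h
    exact (mem_support_iff.mp hm) (by omega)
  refine ⟨monomial (m.mapRange (· / 2) rfl) (coeff m p), ?_⟩
  change expand 2 _ = _
  have h2 : 2 • m.mapRange (· / 2) rfl = m :=
    Finsupp.ext fun k => by simpa using Nat.mul_div_cancel' (heven k)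
  rw [expand_monomial, h2]

/-- The ring homomorphism sending the `i`-th variable to the `i`-th elementary symmetric
polynomial of the squares of the variables. -/
noncomputable def esymmSquares (n : ℕ) : MvPolynomial (Fin n) ℤ →ₐ[ℤ] MvPolynomial (Fin n) ℤ :=
  (MvPolynomial.expand 2).comp
    (MvPolynomial.aeval fun i : Fin n => MvPolynomial.esymm (Fin n) ℤ (i + 1))

open MvPolynomial in
lemma mem_range_esymmSquares {n : ℕ} (p : MvPolynomial (Fin n) ℤ)
    (hp : ∀ k, aeval (fun i => if i = k then -X i else X i : Fin n → MvPolynomial (Fin n) ℤ) p = p)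
    (hs : ∀ e : Equiv.Perm (Fin n), rename e p = p) :
    ∃ q, esymmSquares n q = p := by
  obtain ⟨u, rfl⟩ := mem_range_expand_two p hp
  have hu : u.IsSymmetric := by
    intro e
    have h := hs e
    change rename e (expand 2 u) = expand 2 u at h
    rw [rename_expand] at h
    exact expand_injective two_pos h
  obtain ⟨q, hq⟩ := esymmAlgHom_fin_surjective ℤ (le_refl n) ⟨u, hu⟩
  refine ⟨q, ?_⟩
  have h2 := congrArg Subtype.val hq
  rw [esymmAlgHom_apply] at h2
  change expand 2 (aeval _ q) = expand 2 u
  rw [h2]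

open MvPolynomial in
/-- For odd `n`, `∏ (X - (∑ ± rᵢ)²)` is a universal monic polynomial in the elementary symmetric
functions of the `rᵢ²`. -/
lemma exists_universal_signProd {n : ℕ} (hn : Odd n) :
    ∃ H : Polynomial (MvPolynomial (Fin n) ℤ), H.Monic ∧
      H.map (esymmSquares n).toRingHom = signProd X := by
  have hl : signProd (X : Fin n → MvPolynomial (Fin n) ℤ) ∈
      Polynomial.lifts (esymmSquares n).toRingHom := by
    rw [Polynomial.lifts_iff_coeff_lifts]
    intro k
    refine mem_range_esymmSquares _ (fun i => ?_) fun e => ?_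
    · have h := signProd_map
        (aeval (R := ℤ)
          (fun j => if j = i then -X j else X j : Fin n → MvPolynomial (Fin n) ℤ)).toRingHom X
      have h2 := congrArg (fun q => Polynomial.coeff q k) h
      rw [Polynomial.coeff_map] at h2
      refine h2.trans ?_
      rw [← signProd_neg hn X i]
      simp
    · have h := signProd_map (rename e : MvPolynomial (Fin n) ℤ →ₐ[ℤ] _).toRingHom X
      have h2 := congrArg (fun q => Polynomial.coeff q k) h
      rw [Polynomial.coeff_map] at h2
      refine h2.trans ?_
      rw [← signProd_perm X e]
      simp
  obtain ⟨H, h1, -, h3⟩ := Polynomial.lifts_and_natDegree_eq_and_monic hl (signProd_monic _)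
  exact ⟨H, h3, h1⟩

/-- A universal polynomial as in `exists_universal_signProd`, for odd `n`; the value for even `n`
is immaterial. -/
noncomputable def universalSignProd (n : ℕ) : Polynomial (MvPolynomial (Fin n) ℤ) :=
  if hn : Odd n then (exists_universal_signProd hn).choose else 1

lemma universalSignProd_monic (n : ℕ) : (universalSignProd n).Monic := by
  unfold universalSignProd
  split_ifs with hn
  · exact (exists_universal_signProd hn).choose_spec.1
  · exact Polynomial.monic_one

lemma universalSignProd_map {n : ℕ} (hn : Odd n) :
    (universalSignProd n).map (esymmSquares n).toRingHom =
      signProd MvPolynomial.X := by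
  unfold universalSignProd
  rw [dif_pos hn]
  exact (exists_universal_signProd hn).choose_spec.2

/-- The monic polynomial `∏ (X - (∑ ± rᵢ)²)`, where the `rᵢ²` are the roots of `p`, expressed
through the coefficients of the monic polynomial `p` of odd degree `n`. The substituted values
are the elementary symmetric functions of the roots of `p`. -/
noncomputable def rootSignPoly (n : ℕ) {R : Type*} [CommRing R] (p : Polynomial R) :
    Polynomial R :=
  (universalSignProd n).map (MvPolynomial.aeval (R := ℤ)
    fun i : Fin n => (-1) ^ ((i : ℕ) + 1) * p.coeff (n - (i + 1))).toRingHom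

lemma rootSignPoly_monic (n : ℕ) {R : Type*} [CommRing R] (p : Polynomial R) :
    (rootSignPoly n p).Monic :=
  (universalSignProd_monic n).map _

lemma rootSignPoly_natDegree {m : ℕ} (hm : Odd (m + 1)) {R : Type*} [CommRing R] [Nontrivial R]
    (p : Polynomial R) : (rootSignPoly (m + 1) p).natDegree = 2 ^ m := by
  rw [rootSignPoly, (universalSignProd_monic _).natDegree_map,
    ← (universalSignProd_monic _).natDegree_map (esymmSquares (m + 1)).toRingHom,
    universalSignProd_map hm, signProd_natDegree]

lemma rootSignPoly_map (n : ℕ) {R S : Type*} [CommRing R] [CommRing S] (φ : R →+* S)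
    (p : Polynomial R) : (rootSignPoly n p).map φ = rootSignPoly n (p.map φ) := by
  unfold rootSignPoly
  rw [Polynomial.map_map]
  congr 1
  ext i
  · simp
  · simp

lemma rootSignPoly_eq_signProd {n : ℕ} (hn : Odd n) {R : Type*} [CommRing R]
    (r b : Fin n → R) (hr : ∀ i, r i ^ 2 = b i) :
    rootSignPoly n (∏ i, (Polynomial.X - Polynomial.C (b i))) = signProd r := by
  have h := congrArg (Polynomial.map (MvPolynomial.aeval (R := ℤ) r).toRingHom)
    (universalSignProd_map hn)
  rw [signProd_map, Polynomial.map_map] at h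
  simp only [AlgHom.toRingHom_eq_coe, RingHom.coe_coe, MvPolynomial.aeval_X] at h
  rw [← h, rootSignPoly]
  congr 1
  ext i
  · simp
  · have hv := Multiset.prod_X_sub_C_coeff (Finset.univ.val.map b) (k := n - (i + 1)) (by simp)
    have hc : Multiset.card (Finset.univ.val.map b) - (n - ((i : ℕ) + 1)) = (i : ℕ) + 1 := by
      simp; omega
    rw [hc, Multiset.map_map] at hv
    have hv' : (∏ i, (Polynomial.X - Polynomial.C (b i))).coeff (n - ((i : ℕ) + 1)) =
        (-1) ^ ((i : ℕ) + 1) * (Finset.univ.val.map b).esymm ((i : ℕ) + 1) := hv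
    have hr' : (fun i => r i ^ 2) = b := funext hr
    simp only [AlgHom.toRingHom_eq_coe, RingHom.coe_coe, MvPolynomial.aeval_X,
      RingHom.coe_comp, Function.comp_apply, esymmSquares, AlgHom.comp_apply, hv']
    rw [← mul_assoc, ← pow_add, Even.neg_one_pow ⟨_, rfl⟩, one_mul, MvPolynomial.aeval_expand,
      ← MvPolynomial.aeval_esymm_eq_multiset_esymm (Fin n) ℤ]
    congr 2
    exact hr'.symm

/-! ### The resolvent of a pencil of quadrics -/

/-- The antidiagonal matrix `A₀` over an arbitrary ring. -/
def revMatrix (n : ℕ) (R : Type*) [Zero R] [One R] : Matrix (Fin n) (Fin n) R :=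
  Matrix.of fun i j => if j = Fin.rev i then 1 else 0

lemma revMatrix_rat (n : ℕ) : revMatrix n ℚ = antidiagMatrix n := rfl

lemma revMatrix_map (n : ℕ) {R S : Type*} [CommRing R] [CommRing S] (φ : R →+* S) :
    (revMatrix n R).map φ = revMatrix n S := by
  ext i j
  simp [revMatrix, apply_ite φ]

lemma revMatrix_transpose (n : ℕ) (R : Type*) [Zero R] [One R] :
    (revMatrix n R)ᵀ = revMatrix n R := by
  ext i j
  simp only [revMatrix, Matrix.transpose_apply, Matrix.of_apply]
  congr 1
  rw [← Fin.rev_eq_iff]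
  exact propext eq_comm

lemma revMatrix_mulVec (n : ℕ) {R : Type*} [CommRing R] (v : Fin n → R) (i : Fin n) :
    (revMatrix n R *ᵥ v) i = v (Fin.rev i) := by
  simp [revMatrix, Matrix.mulVec, dotProduct]

lemma revMatrix_mul_self (n : ℕ) (R : Type*) [CommRing R] :
    revMatrix n R * revMatrix n R = 1 := by
  ext i j
  simp only [revMatrix, Matrix.mul_apply, Matrix.of_apply, ite_mul, one_mul, zero_mul,
    Finset.sum_ite_eq', Finset.mem_univ, if_true, Fin.rev_rev,
    Matrix.one_apply, @eq_comm _ i j]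

/-- The polynomial `β` whose value at a root `l` of the characteristic polynomial `f` of `T` is
`wᵗ A q(T) w`, where `q = f / (X - l)`. For `A T` symmetric and `l` a simple root, this is `f'(l)`
times the value of the form `A` at the `l`-component of `w`. -/
noncomputable def componentPoly {n : ℕ} {R : Type*} [CommRing R]
    (A T : Matrix (Fin n) (Fin n) R) (w : Fin n → R) : Polynomial R :=
  ∑ b ∈ Finset.range n, ∑ k ∈ Finset.Icc (b + 1) n,
    Polynomial.C (T.charpoly.coeff k * (w ⬝ᵥ (A *ᵥ (T ^ b *ᵥ w)))) * Polynomial.X ^ (k - (b + 1))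

lemma componentPoly_map {n : ℕ} {R S : Type*} [CommRing R] [CommRing S] (φ : R →+* S)
    (A T : Matrix (Fin n) (Fin n) R) (w : Fin n → R) :
    (componentPoly A T w).map φ = componentPoly (A.map φ) (T.map φ) (φ ∘ w) := by
  have hT : ∀ b : ℕ, (T ^ b).map φ = T.map φ ^ b := fun b => map_pow φ.mapMatrix T b
  simp only [componentPoly, Polynomial.map_sum, Polynomial.map_mul, Polynomial.map_C φ,
    Polynomial.map_pow, Polynomial.map_X, Matrix.charpoly_map, Polynomial.coeff_map, ← hT]
  refine Finset.sum_congr rfl fun b _ => Finset.sum_congr rfl fun k _ => ?_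
  have h : φ ∘ (A *ᵥ (T ^ b *ᵥ w)) = A.map φ *ᵥ ((T ^ b).map φ *ᵥ (φ ∘ w)) := by
    ext i
    rw [Function.comp_apply, RingHom.map_mulVec]
    congr 2
    ext j
    rw [Function.comp_apply, RingHom.map_mulVec]
  rw [map_mul φ, RingHom.map_dotProduct φ, h]

lemma pairing_aeval {n : ℕ} {R : Type*} [CommRing R] (A T : Matrix (Fin n) (Fin n) R)
    (w w' : Fin n → R) {p : Polynomial R} {m : ℕ} (hp : p.natDegree < m) :
    w ⬝ᵥ (A *ᵥ (Polynomial.aeval T p *ᵥ w')) =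
      ∑ b ∈ Finset.range m, p.coeff b * (w ⬝ᵥ (A *ᵥ (T ^ b *ᵥ w'))) := by
  rw [Polynomial.aeval_eq_sum_range' hp, Matrix.sum_mulVec, Matrix.mulVec_sum, dotProduct_sum]
  simp [Matrix.smul_mulVec, Matrix.mulVec_smul]

lemma natDegree_charpoly_divByMonic {m : ℕ} {R : Type*} [CommRing R] [Nontrivial R]
    (T : Matrix (Fin (m + 1)) (Fin (m + 1)) R) (l : R) :
    (T.charpoly /ₘ (Polynomial.X - Polynomial.C l)).natDegree = m := by
  rw [Polynomial.natDegree_divByMonic _ (Polynomial.monic_X_sub_C l),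
    Matrix.charpoly_natDegree_eq_dim]
  simp

lemma eval_componentPoly {m : ℕ} {R : Type*} [CommRing R] [Nontrivial R]
    (A T : Matrix (Fin (m + 1)) (Fin (m + 1)) R) (w : Fin (m + 1) → R) (l : R) :
    (componentPoly A T w).eval l = w ⬝ᵥ (A *ᵥ
      (Polynomial.aeval T (T.charpoly /ₘ (Polynomial.X - Polynomial.C l)) *ᵥ w)) := by
  rw [pairing_aeval A T w w (m := m + 1) (by rw [natDegree_charpoly_divByMonic]; omega),
    componentPoly, Polynomial.eval_finsetSum]
  refine Finset.sum_congr rfl fun b _ => ?_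
  rw [Polynomial.coeff_divByMonic_X_sub_C, Matrix.charpoly_natDegree_eq_dim, Fintype.card_fin,
    Polynomial.eval_finsetSum, Finset.sum_mul]
  refine Finset.sum_congr rfl fun k _ => ?_
  simp
  ring

lemma aeval_mul_of_intertwine {n : ℕ} {R : Type*} [CommRing R] {T Q : Matrix (Fin n) (Fin n) R}
    {l : Fin n → R} (h : T * Q = Q * Matrix.diagonal l) (p : Polynomial R) :
    Polynomial.aeval T p * Q = Q * Matrix.diagonal fun i => p.eval (l i) := by
  induction p using Polynomial.induction_on' with
  | add p q hp hq =>
    rw [map_add, add_mul, hp, hq, ← mul_add, Matrix.diagonal_add]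
    simp
  | monomial k a =>
    have hk : T ^ k * Q = Q * Matrix.diagonal (fun i => l i ^ k) := by
      have := (SemiconjBy.pow_right (a := Q) (x := Matrix.diagonal l) (y := T) h.symm k).eq
      rw [← this, Matrix.diagonal_pow]
      rfl
    rw [Polynomial.aeval_monomial, mul_assoc, hk, ← mul_assoc, Algebra.commutes a, mul_assoc]
    congr 1
    rw [Matrix.algebraMap_eq_diagonal, Matrix.diagonal_mul_diagonal]
    simp

lemma charpoly_aeval_of_intertwine {n : ℕ} {R : Type*} [CommRing R]
    {T Q : Matrix (Fin n) (Fin n) R} {l : Fin n → R} (hQ : IsUnit Q)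
    (h : T * Q = Q * Matrix.diagonal l) (p : Polynomial R) :
    (Polynomial.aeval T p).charpoly = ∏ i, (Polynomial.X - Polynomial.C (p.eval (l i))) := by
  have h1 := aeval_mul_of_intertwine h p
  obtain ⟨u, rfl⟩ := hQ
  have h2 : Polynomial.aeval T p =
      (u : Matrix (Fin n) (Fin n) R) * (Matrix.diagonal (fun i => p.eval (l i)) *
        (↑u⁻¹ : Matrix (Fin n) (Fin n) R)) := by
    rw [← mul_assoc, ← h1, mul_assoc, Units.mul_inv, mul_one]
  rw [h2, Matrix.charpoly_mul_comm, mul_assoc, Units.inv_mul, mul_one, Matrix.charpoly_diagonal]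

/-- The resolvent `∏ (X - (∑ ± √β(lᵢ))²)` attached to a matrix `B`, where the `lᵢ` are the
eigenvalues of `T = A₀ B` and `β` is the component polynomial of the all-ones vector. -/
noncomputable def pencilResolvent {n : ℕ} {R : Type*} [CommRing R]
    (B : Matrix (Fin n) (Fin n) R) : Polynomial R :=
  rootSignPoly n (Polynomial.aeval (revMatrix n R * B)
    (componentPoly (revMatrix n R) (revMatrix n R * B) 1)).charpoly

lemma pencilResolvent_monic {n : ℕ} {R : Type*} [CommRing R]
    (B : Matrix (Fin n) (Fin n) R) : (pencilResolvent B).Monic :=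
  rootSignPoly_monic _ _

lemma pencilResolvent_map {n : ℕ} {R S : Type*} [CommRing R] [CommRing S] (φ : R →+* S)
    (B : Matrix (Fin n) (Fin n) R) :
    (pencilResolvent B).map φ = pencilResolvent (B.map φ) := by
  have hT : (revMatrix n R * B).map φ = revMatrix n S * B.map φ := by
    rw [Matrix.map_mul, revMatrix_map]
  have h1 : φ ∘ (1 : Fin n → R) = 1 := by ext; simp
  have h2 : ∀ p : Polynomial R, (Polynomial.aeval (revMatrix n R * B) p).map φ =
      Polynomial.aeval (revMatrix n S * B.map φ) (p.map φ) := by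
    intro p
    rw [← hT]
    have := Polynomial.map_aeval_eq_aeval_map (φ := φ) (ψ := φ.mapMatrix (m := Fin n))
      (by ext r i j; simp [Matrix.algebraMap_matrix_apply, apply_ite φ]) p (revMatrix n R * B)
    exact this
  rw [pencilResolvent, rootSignPoly_map, ← Matrix.charpoly_map, h2, componentPoly_map, hT, h1,
    revMatrix_map]
  rfl

lemma pencilResolvent_map_eq_signProd {n : ℕ} (hn : Odd n) {R S : Type*} [CommRing R]
    [CommRing S] (φ : R →+* S) {B Q : Matrix (Fin n) (Fin n) R} {l : Fin n → R} (hQ : IsUnit Q)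
    (h : revMatrix n R * B * Q = Q * Matrix.diagonal l) (r : Fin n → S)
    (hr : ∀ i, r i ^ 2 =
      φ ((componentPoly (revMatrix n R) (revMatrix n R * B) 1).eval (l i))) :
    (pencilResolvent B).map φ = signProd r := by
  rw [pencilResolvent, rootSignPoly_map, charpoly_aeval_of_intertwine hQ h, Polynomial.map_prod,
    ← rootSignPoly_eq_signProd hn r _ hr]
  simp only [Polynomial.map_sub, Polynomial.map_X, Polynomial.map_C]

/-! ### Eigenbases of self-adjoint matrices -/

lemma Polynomial.separable_of_discr_ne_zero {K : Type*} [Field K] [CharZero K] {f : Polynomial K}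
    (hf : 0 < f.natDegree) (h : f.discr ≠ 0) : f.Separable := by
  have h1 := Polynomial.resultant_deriv (f := f) (Polynomial.natDegree_pos_iff_degree_pos.mp hf)
  have h2 : f.derivative.natDegree = f.natDegree - 1 := Polynomial.natDegree_derivative f
  have h0 : f ≠ 0 := by rintro rfl; simp at hf
  rw [← h2] at h1
  by_contra hs
  have h3 : Polynomial.resultant f f.derivative = 0 := by
    rw [Polynomial.resultant_eq_zero_iff]
    exact ⟨Or.inl h0, hs⟩
  rw [h3] at h1
  have := Polynomial.leadingCoeff_ne_zero.mpr h0
  simp_all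

lemma charpoly_separable_of_matDisc_ne_zero {n : ℕ} (hn : 0 < n) {B : Matrix (Fin n) (Fin n) ℚ}
    (h : matDisc B ≠ 0) : (revMatrix n ℚ * B).charpoly.Separable := by
  have hdet : (revMatrix n ℚ).det * (revMatrix n ℚ).det = 1 := by
    rw [← Matrix.det_mul, revMatrix_mul_self, Matrix.det_one]
  have hd : (revMatrix n ℚ).det ≠ 0 := left_ne_zero_of_mul_eq_one hdet
  have hAA : ((revMatrix n ℚ).map Polynomial.C) * ((revMatrix n ℚ).map Polynomial.C) = 1 := by
    rw [← Matrix.map_mul, revMatrix_mul_self]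
    simp
  have hmul : (Polynomial.X : Polynomial ℚ) • (antidiagMatrix n).map Polynomial.C
      - B.map Polynomial.C =
      (revMatrix n ℚ).map Polynomial.C * (revMatrix n ℚ * B).charmatrix := by
    rw [Matrix.charmatrix, mul_sub, RingHom.mapMatrix_apply, Matrix.map_mul, ← mul_assoc, hAA,
      one_mul, Matrix.scalar_apply, ← Matrix.smul_one_eq_diagonal, mul_smul_comm, mul_one]
    rfl
  have hres : resolventPoly B = Polynomial.C ((-1) ^ (n * (n - 1) / 2) * (revMatrix n ℚ).det) *
      (revMatrix n ℚ * B).charpoly := by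
    rw [resolventPoly, hmul, Matrix.det_mul, ← RingHom.mapMatrix_apply, ← RingHom.map_det,
      Matrix.charpoly]
    simp [mul_assoc]
  have hc : (-1) ^ (n * (n - 1) / 2) * (revMatrix n ℚ).det ≠ 0 :=
    mul_ne_zero (pow_ne_zero _ (by norm_num)) hd
  have hs : (resolventPoly B).Separable := by
    refine Polynomial.separable_of_discr_ne_zero ?_ h
    rw [hres, Polynomial.natDegree_C_mul hc, Matrix.charpoly_natDegree_eq_dim]
    simpa using hn
  rw [hres] at hs
  exact hs.of_mul_right

lemma Matrix.exists_eigenbasis {n : ℕ} {K : Type*} [Field K] [IsAlgClosed K]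
    {T : Matrix (Fin n) (Fin n) K} (hT : T.charpoly.Separable) :
    ∃ (l : Fin n → K) (Q : Matrix (Fin n) (Fin n) K), Function.Injective l ∧
      (∀ i, T.charpoly.IsRoot (l i)) ∧ IsUnit Q ∧ T * Q = Q * Matrix.diagonal l := by
  classical
  have hcard : T.charpoly.roots.toFinset.card = n := by
    rw [Multiset.toFinset_card_of_nodup (Polynomial.nodup_roots hT),
      ← (IsAlgClosed.splits T.charpoly).natDegree_eq_card_roots, Matrix.charpoly_natDegree_eq_dim,
      Fintype.card_fin]
  set e := (Finset.equivFinOfCardEq hcard).symm with he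
  set l : Fin n → K := fun i => (e i : K) with hl
  have hinj : Function.Injective l := Subtype.val_injective.comp e.injective
  have hroot : ∀ i, T.charpoly.IsRoot (l i) := fun i =>
    Polynomial.isRoot_of_mem_roots (Multiset.mem_toFinset.mp (e i).2)
  have hv : ∀ i, ∃ v : Fin n → K, v ≠ 0 ∧ T *ᵥ v = l i • v := by
    intro i
    have h1 : (Matrix.scalar (Fin n) (l i) - T).det = 0 := by
      rw [← Matrix.eval_charpoly]; exact hroot i
    obtain ⟨v, hv0, hv⟩ := Matrix.exists_mulVec_eq_zero_iff.mpr h1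
    refine ⟨v, hv0, ?_⟩
    rw [Matrix.sub_mulVec, sub_eq_zero] at hv
    rw [← hv, Matrix.scalar_apply, ← Matrix.smul_one_eq_diagonal, Matrix.smul_mulVec,
      Matrix.one_mulVec]
  choose v hv0 hv using hv
  refine ⟨l, Matrix.of fun i j => v j i, hinj, hroot, ?_, ?_⟩
  · rw [← Matrix.linearIndependent_cols_iff_isUnit]
    exact Module.End.eigenvectors_linearIndependent' T.mulVecLin l hinj v fun i =>
      Module.End.hasEigenvector_iff.mpr ⟨Module.End.mem_eigenspace_iff.mpr (hv i), hv0 i⟩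
  · ext i j
    have := congrFun (hv j) i
    rw [Matrix.mul_diagonal, Matrix.mul_apply]
    simpa [Matrix.mulVec, dotProduct, mul_comm] using this

lemma dotProduct_selfAdjoint {n : ℕ} {R : Type*} [CommRing R] {A T : Matrix (Fin n) (Fin n) R}
    (hA : Aᵀ = A) (hAT : (A * T)ᵀ = A * T) (u v : Fin n → R) :
    (T *ᵥ u) ⬝ᵥ (A *ᵥ v) = u ⬝ᵥ (A *ᵥ (T *ᵥ v)) := by
  rw [Matrix.transpose_mul, hA] at hAT
  rw [Matrix.mulVec_mulVec, ← hAT, ← Matrix.mulVec_mulVec, Matrix.dotProduct_mulVec u,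
    Matrix.vecMul_transpose]

lemma dotProduct_selfAdjoint_pow {n : ℕ} {R : Type*} [CommRing R]
    {A T : Matrix (Fin n) (Fin n) R} (hA : Aᵀ = A) (hAT : (A * T)ᵀ = A * T) (u v : Fin n → R)
    (k : ℕ) : ((T ^ k) *ᵥ u) ⬝ᵥ (A *ᵥ v) = u ⬝ᵥ (A *ᵥ ((T ^ k) *ᵥ v)) := by
  refine dotProduct_selfAdjoint hA ?_ u v
  rw [Matrix.transpose_mul, hA] at *
  have : SemiconjBy A T Tᵀ := hAT.symm
  rw [Matrix.transpose_pow]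
  exact ((this.pow_right k).eq).symm

lemma dotProduct_selfAdjoint_aeval {n : ℕ} {R : Type*} [CommRing R]
    {A T : Matrix (Fin n) (Fin n) R} (hA : Aᵀ = A) (hAT : (A * T)ᵀ = A * T) (u v : Fin n → R)
    (p : Polynomial R) :
    (Polynomial.aeval T p *ᵥ u) ⬝ᵥ (A *ᵥ v) = u ⬝ᵥ (A *ᵥ (Polynomial.aeval T p *ᵥ v)) := by
  induction p using Polynomial.induction_on' with
  | add p q hp hq =>
    simp only [map_add, Matrix.add_mulVec, add_dotProduct, Matrix.mulVec_add, dotProduct_add,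
      hp, hq]
  | monomial k a =>
    simp only [Polynomial.aeval_monomial, ← Algebra.smul_def, Matrix.smul_mulVec,
      smul_dotProduct, Matrix.mulVec_smul, dotProduct_smul, dotProduct_selfAdjoint_pow hA hAT]

/-- In an eigenbasis with distinct eigenvalues the form `A` becomes diagonal, so that the moments
`⟨y, T ^ k y⟩` of a vector determine the squares of its coordinates by Vandermonde. -/
lemma eq_zero_of_moments_eq_zero {n : ℕ} {K : Type*} [Field K]
    {A T Q : Matrix (Fin n) (Fin n) K} {l : Fin n → K} (hA : Aᵀ = A) (hdet : IsUnit A)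
    (hAT : (A * T)ᵀ = A * T) (hl : Function.Injective l) (hQ : IsUnit Q)
    (h : T * Q = Q * Matrix.diagonal l) {y : Fin n → K}
    (hy : ∀ k < n, y ⬝ᵥ (A *ᵥ (T ^ k *ᵥ y)) = 0) : y = 0 := by
  obtain ⟨c, rfl⟩ : ∃ c, Q *ᵥ c = y := by
    obtain ⟨u, rfl⟩ := hQ
    exact ⟨(↑u⁻¹ : Matrix (Fin n) (Fin n) K) *ᵥ y, by simp [Matrix.mulVec_mulVec]⟩
  set G := Qᵀ * A * Q with hG
  have hGt : Gᵀ = G := by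
    simp [hG, Matrix.transpose_mul, hA, mul_assoc]
  have hGl : (G * Matrix.diagonal l)ᵀ = G * Matrix.diagonal l := by
    have : G * Matrix.diagonal l = Qᵀ * (A * T) * Q := by
      rw [hG, mul_assoc, ← h]; simp only [mul_assoc]
    rw [this, Matrix.transpose_mul, Matrix.transpose_mul, hAT]
    simp [mul_assoc]
  have hGoff : ∀ i j, i ≠ j → G i j = 0 := by
    intro i j hij
    have h1 := congrFun (congrFun hGl i) j
    rw [Matrix.transpose_apply, Matrix.mul_diagonal, Matrix.mul_diagonal] at h1
    have h2 : G j i = G i j := congrFun (congrFun hGt i) j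
    rw [h2, ← sub_eq_zero, ← mul_sub] at h1
    rcases mul_eq_zero.mp h1 with h3 | h3
    · exact h3
    · exact absurd (hl (sub_eq_zero.mp h3)) hij
  have hGd : G = Matrix.diagonal fun i => G i i := by
    ext i j
    by_cases hij : i = j
    · subst hij; simp
    · rw [hGoff i j hij, Matrix.diagonal_apply_ne _ hij]
  have hGu : IsUnit G := by
    rw [hG]
    exact (((Matrix.isUnit_transpose Q).mpr hQ).mul hdet).mul hQ
  have hGii : ∀ i, G i i ≠ 0 := by
    intro i hi
    rw [Matrix.isUnit_iff_isUnit_det, hGd, Matrix.det_diagonal] at hGu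
    exact hGu.ne_zero (Finset.prod_eq_zero (Finset.mem_univ i) hi)
  have hsum : ∀ k : Fin n, ∑ j, (c j * (G j j * c j)) * l j ^ (k : ℕ) = 0 := by
    intro k
    rw [← hy k k.2]
    have hk : T ^ (k : ℕ) * Q = Q * Matrix.diagonal (fun i => l i ^ (k : ℕ)) := by
      have := aeval_mul_of_intertwine h (Polynomial.X ^ (k : ℕ))
      simpa using this
    have : (Q *ᵥ c) ⬝ᵥ (A *ᵥ (T ^ (k : ℕ) *ᵥ (Q *ᵥ c))) =
        c ⬝ᵥ ((G * Matrix.diagonal fun i => l i ^ (k : ℕ)) *ᵥ c) := by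
      rw [Matrix.mulVec_mulVec c, hk, ← Matrix.vecMul_transpose, ← Matrix.dotProduct_mulVec, hG]
      simp only [Matrix.mulVec_mulVec, mul_assoc]
    rw [this, hGd, Matrix.diagonal_mul_diagonal, dotProduct]
    refine Finset.sum_congr rfl fun j _ => ?_
    rw [Matrix.mulVec_diagonal]
    simp
    ring
  have hc := Matrix.eq_zero_of_forall_pow_sum_mul_pow_eq_zero hl hsum
  have hc0 : c = 0 := by
    ext j
    have := congrFun hc j
    simpa [hGii j] using this
  rw [hc0, Matrix.mulVec_zero]

/-! ### Distinguished matrices give rational roots -/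

/-- A `g`-dimensional subspace isotropic for both forms contains a nonzero vector `y` with
`y, T y, …, T ^ (g - 1) y` all in the subspace: `T` maps `Y` to `Yᗮ`, in which `Y` has
codimension one, so that each further step costs one linear condition. -/
lemma exists_cyclic_vector_in_isotropic {g : ℕ} (hg : 0 < g)
    {A T : Matrix (Fin (2 * g + 1)) (Fin (2 * g + 1)) ℚ} (hdet : IsUnit A)
    {Y : Submodule ℚ (Fin (2 * g + 1) → ℚ)} (hY : Module.finrank ℚ Y = g)
    (hYA : ∀ u ∈ Y, ∀ v ∈ Y, u ⬝ᵥ (A *ᵥ v) = 0)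
    (hYT : ∀ u ∈ Y, ∀ v ∈ Y, u ⬝ᵥ (A *ᵥ (T *ᵥ v)) = 0) :
    ∃ y ∈ Y, y ≠ 0 ∧ ∀ k < g, T ^ k *ᵥ y ∈ Y := by
  set β : LinearMap.BilinForm ℚ (Fin (2 * g + 1) → ℚ) := Matrix.toBilin' A with hβ
  have hβa : ∀ u v, β u v = u ⬝ᵥ (A *ᵥ v) := fun u v => Matrix.toBilin'_apply' A u v
  have hnd : β.Nondegenerate := by
    rw [hβ, LinearMap.BilinForm.nondegenerate_toBilin'_iff_det_ne_zero]
    exact ((Matrix.isUnit_iff_isUnit_det A).mp hdet).ne_zero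
  have hfr := LinearMap.BilinForm.finrank_orthogonal hnd Y
  rw [hY, Module.finrank_fin_fun] at hfr
  set Z := β.orthogonal Y with hZ
  have hmemZ : ∀ v, v ∈ Z ↔ ∀ u ∈ Y, u ⬝ᵥ (A *ᵥ v) = 0 := by
    intro v
    simp only [hZ, LinearMap.BilinForm.mem_orthogonal_iff, hβa]
  have hYZ : Y ≤ Z := fun v hv => (hmemZ v).mpr fun u hu => hYA u hu v hv
  have hTZ : ∀ v ∈ Y, T *ᵥ v ∈ Z := fun v hv => (hmemZ _).mpr fun u hu => hYT u hu v hv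
  obtain ⟨z, hzZ, hzY⟩ : ∃ z ∈ Z, z ∉ Y := by
    by_contra hcon
    push Not at hcon
    have := Submodule.finrank_mono (show Z ≤ Y from hcon)
    omega
  obtain ⟨φ, hφz, hφY⟩ := Submodule.exists_le_ker_of_notMem hzY
  have hker : Y = Z ⊓ LinearMap.ker φ := by
    refine Submodule.eq_of_le_of_finrank_le (le_inf hYZ hφY) ?_
    have hlt : Z ⊓ LinearMap.ker φ < Z := lt_of_le_of_ne inf_le_left fun h =>
      hφz (LinearMap.mem_ker.mp ((Submodule.mem_inf.mp (h.symm ▸ hzZ)).2))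
    have := Submodule.finrank_lt_finrank_of_lt hlt
    omega
  set Φ : Y →ₗ[ℚ] (Fin (g - 1) → ℚ) :=
    LinearMap.pi fun k => φ ∘ₗ (T ^ ((k : ℕ) + 1)).mulVecLin ∘ₗ Y.subtype with hΦ
  have hΦker : LinearMap.ker Φ ≠ ⊥ := by
    apply LinearMap.ker_ne_bot_of_finrank_lt
    rw [hY, Module.finrank_fin_fun]
    omega
  obtain ⟨y, hy, hy0⟩ := Submodule.exists_mem_ne_zero_of_ne_bot hΦker
  refine ⟨y, y.2, fun h => hy0 (Subtype.ext h), ?_⟩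
  intro k
  induction k with
  | zero => intro _; simp
  | succ k ih =>
    intro hk
    have h1 := hTZ _ (ih (by omega))
    rw [Matrix.mulVec_mulVec, ← pow_succ'] at h1
    refine hker.ge (Submodule.mem_inf.mpr ⟨h1, LinearMap.mem_ker.mpr ?_⟩)
    exact congrFun (LinearMap.mem_ker.mp hy) ⟨k, by omega⟩

lemma polarize_isotropic {n : ℕ} {M : Matrix (Fin n) (Fin n) ℚ} (hM : Mᵀ = M)
    {Y : Submodule ℚ (Fin n → ℚ)} (hY : IsIsotropicFor M Y) :
    ∀ u ∈ Y, ∀ v ∈ Y, u ⬝ᵥ (M *ᵥ v) = 0 := by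
  intro u hu v hv
  have h1 := hY _ (Y.add_mem hu hv)
  have h2 := hY u hu
  have h3 := hY v hv
  have h4 : v ⬝ᵥ (M *ᵥ u) = u ⬝ᵥ (M *ᵥ v) := by
    rw [Matrix.dotProduct_mulVec, ← Matrix.mulVec_transpose, hM, dotProduct_comm]
  rw [Matrix.mulVec_add, dotProduct_add, add_dotProduct, add_dotProduct, h2, h3, h4] at h1
  linarith

/-- A vector whose moments `⟨y, T ^ k y⟩` vanish for `k < m` but not for `k = m` is cyclic: the
Gram matrix of `y, T y, …, T ^ m y` is triangular along the antidiagonal. -/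
lemma exists_aeval_mulVec_eq {m : ℕ} {K : Type*} [Field K]
    {A T : Matrix (Fin (m + 1)) (Fin (m + 1)) K} {y : Fin (m + 1) → K}
    (h0 : ∀ k < m, y ⬝ᵥ (A *ᵥ (T ^ k *ᵥ y)) = 0) (h1 : y ⬝ᵥ (A *ᵥ (T ^ m *ᵥ y)) ≠ 0)
    (w : Fin (m + 1) → K) : ∃ p : Polynomial K, Polynomial.aeval T p *ᵥ y = w := by
  have hli : LinearIndependent K fun k : Fin (m + 1) => T ^ (k : ℕ) *ᵥ y := by
    rw [Fintype.linearIndependent_iff]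
    intro c hc
    by_contra hcon
    push Not at hcon
    classical
    set s := Finset.univ.filter fun i : Fin (m + 1) => c i ≠ 0 with hs
    have hsne : s.Nonempty := hcon.imp fun i hi => by simp [hs, hi]
    have hdmem := s.max'_mem hsne
    have hdmax : ∀ j, s.max' hsne < j → c j = 0 := by
      intro j hj
      by_contra hcj
      exact absurd (s.le_max' j (by simp [hs, hcj])) (not_le.mpr hj)
    set d := s.max' hsne with hd
    have hcd : c d ≠ 0 := by simpa [hs] using hdmem
    -- pairing the relation with `T ^ (m - d) y` isolates its coefficient of highest index `d`
    have hpair := congrArg (fun v => y ⬝ᵥ (A *ᵥ (T ^ (m - (d : ℕ)) *ᵥ v))) hc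
    simp only [Matrix.mulVec_sum, dotProduct_sum, Matrix.mulVec_smul, dotProduct_smul,
      Matrix.mulVec_zero, dotProduct_zero, smul_eq_mul] at hpair
    rw [Finset.sum_eq_single d] at hpair
    · rw [Matrix.mulVec_mulVec y (T ^ (m - (d : ℕ))), ← pow_add,
        Nat.sub_add_cancel (by omega)] at hpair
      exact (mul_ne_zero hcd h1) hpair
    · intro j _ hjd
      rcases lt_or_gt_of_ne hjd with hlt | hgt
      · rw [Matrix.mulVec_mulVec y (T ^ (m - (d : ℕ))), ← pow_add, h0, mul_zero]
        have : (j : ℕ) < d := hlt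
        omega
      · rw [hdmax j hgt, zero_mul]
    · simp
  have hspan := hli.span_eq_top_of_card_eq_finrank (by simp)
  have hw : w ∈ Submodule.span K (Set.range fun k : Fin (m + 1) => T ^ (k : ℕ) *ᵥ y) := by
    rw [hspan]; trivial
  obtain ⟨c, hc⟩ := (Submodule.mem_span_range_iff_exists_fun K).mp hw
  refine ⟨∑ k, Polynomial.C (c k) * Polynomial.X ^ (k : ℕ), ?_⟩
  rw [← hc, map_sum, Matrix.sum_mulVec]
  refine Finset.sum_congr rfl fun k _ => ?_
  simp [← Algebra.smul_def, Matrix.smul_mulVec]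

lemma aeval_mul_eq_smul {n : ℕ} {R : Type*} [CommRing R] {T E : Matrix (Fin n) (Fin n) R} {l : R}
    (h : T * E = l • E) (p : Polynomial R) : Polynomial.aeval T p * E = p.eval l • E := by
  induction p using Polynomial.induction_on' with
  | add p q hp hq => rw [map_add, add_mul, hp, hq, Polynomial.eval_add, add_smul]
  | monomial k a =>
    have hk : T ^ k * E = l ^ k • E := by
      induction k with
      | zero => simp
      | succ k ih => rw [pow_succ, mul_assoc, h, mul_smul_comm, ih, smul_smul, pow_succ, mul_comm]
    rw [Polynomial.aeval_monomial, mul_assoc, hk, ← Algebra.smul_def, smul_smul,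
      Polynomial.eval_monomial]

/-- For `w = h(T) y` with `y` having vanishing moments below the top one `κ`, the component
polynomial takes the value `h(l)² κ` at each eigenvalue `l`. -/
lemma eval_componentPoly_of_moments {m : ℕ} {R : Type*} [CommRing R] [Nontrivial R]
    {A T : Matrix (Fin (m + 1)) (Fin (m + 1)) R} (hA : Aᵀ = A) (hAT : (A * T)ᵀ = A * T)
    {y : Fin (m + 1) → R} (h0 : ∀ k < m, y ⬝ᵥ (A *ᵥ (T ^ k *ᵥ y)) = 0)
    (p : Polynomial R) {l : R} (hl : T.charpoly.IsRoot l) :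
    (componentPoly A T (Polynomial.aeval T p *ᵥ y)).eval l =
      p.eval l ^ 2 * (y ⬝ᵥ (A *ᵥ (T ^ m *ᵥ y))) := by
  rw [eval_componentPoly]
  set q := T.charpoly /ₘ (Polynomial.X - Polynomial.C l) with hq
  have hTE : T * Polynomial.aeval T q = l • Polynomial.aeval T q := by
    have h1 := congrArg (Polynomial.aeval T) (Polynomial.mul_divByMonic_eq_iff_isRoot.mpr hl)
    rw [Matrix.aeval_self_charpoly, map_mul, map_sub, Polynomial.aeval_X, Polynomial.aeval_C,
      sub_mul, sub_eq_zero, ← Algebra.smul_def] at h1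
    exact h1
  have hpE := aeval_mul_eq_smul hTE p
  have hEp : Polynomial.aeval T q * Polynomial.aeval T p = p.eval l • Polynomial.aeval T q := by
    rw [← hpE, ← map_mul, ← map_mul, mul_comm]
  have hdeg : q.natDegree = m := natDegree_charpoly_divByMonic T l
  have hmonic : q.coeff m = 1 := by
    have hm : q.Monic := by
      refine Polynomial.Monic.of_mul_monic_left (Polynomial.monic_X_sub_C l) ?_
      rw [hq, Polynomial.mul_divByMonic_eq_iff_isRoot.mpr hl]
      exact T.charpoly_monic
    rw [← hdeg]; exact hm
  rw [dotProduct_selfAdjoint_aeval hA hAT, Matrix.mulVec_mulVec y, hEp,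
    Matrix.smul_mulVec, Matrix.mulVec_smul, Matrix.mulVec_mulVec, hpE, Matrix.smul_mulVec,
    Matrix.mulVec_smul, dotProduct_smul, Matrix.mulVec_smul, dotProduct_smul,
    pairing_aeval A T y y (m := m + 1) (by omega),
    Finset.sum_range_succ, Finset.sum_eq_zero, hmonic]
  · simp only [smul_eq_mul]; ring
  · intro b hb
    rw [h0 b (Finset.mem_range.mp hb), mul_zero]

lemma IsDistinguished.exists_vanishing_moments {g : ℕ}
    {B : Matrix (Fin (2 * g + 1)) (Fin (2 * g + 1)) ℚ} (hB : IsDistinguished B) :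
    ∃ y : Fin (2 * g + 1) → ℚ, y ≠ 0 ∧ ∀ k < 2 * g,
      y ⬝ᵥ (revMatrix _ ℚ *ᵥ ((revMatrix _ ℚ * B) ^ k *ᵥ y)) = 0 := by
  obtain ⟨hsymm, -, Y, hY, hYA, hYB⟩ := hB
  rw [← revMatrix_rat] at hYA
  have hAA := revMatrix_mul_self (2 * g + 1) ℚ
  have hAt := revMatrix_transpose (2 * g + 1) ℚ
  have hAT : revMatrix (2 * g + 1) ℚ * (revMatrix _ ℚ * B) = B := by
    rw [← mul_assoc, hAA, one_mul]
  have hATt : (revMatrix (2 * g + 1) ℚ * (revMatrix _ ℚ * B))ᵀ =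
      revMatrix (2 * g + 1) ℚ * (revMatrix _ ℚ * B) := by
    rw [hAT]; exact hsymm
  have hYA' := polarize_isotropic hAt hYA
  have hYT : ∀ u ∈ Y, ∀ v ∈ Y,
      u ⬝ᵥ (revMatrix _ ℚ *ᵥ ((revMatrix _ ℚ * B) *ᵥ v)) = 0 := by
    intro u hu v hv
    rw [Matrix.mulVec_mulVec, hAT]
    exact polarize_isotropic hsymm hYB u hu v hv
  rcases Nat.eq_zero_or_pos g with rfl | hg
  · exact ⟨1, one_ne_zero, fun k hk => absurd hk (by omega)⟩
  obtain ⟨y, -, hy0, hyT⟩ := exists_cyclic_vector_in_isotropic hg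
    (IsUnit.of_mul_eq_one _ hAA) hY hYA' hYT
  refine ⟨y, hy0, fun k hk => ?_⟩
  by_cases hkg : k < g
  · have h := hYA' _ (hyT 0 hg) _ (hyT k hkg)
    rwa [pow_zero, Matrix.one_mulVec] at h
  · have h := hYT _ (hyT (k - g) (by omega)) _ (hyT (g - 1) (by omega))
    rw [dotProduct_selfAdjoint_pow hAt hATt, Matrix.mulVec_mulVec _ (_ * B), ← pow_succ',
      Matrix.mulVec_mulVec _ (_ ^ (k - g)), ← pow_add, show k - g + (g - 1 + 1) = k by omega] at h
    exact h

/-- For distinguished `B` one has `βᵢ = κ h(lᵢ)²` with `κ` and `h` rational, so that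
`(∑ √βᵢ)² = κ (tr h(T))²` is a rational root of the resolvent. -/
theorem IsDistinguished.exists_root_pencilResolvent {g : ℕ}
    {B : Matrix (Fin (2 * g + 1)) (Fin (2 * g + 1)) ℚ} (hB : IsDistinguished B) :
    ∃ q : ℚ, (pencilResolvent B).IsRoot q := by
  obtain ⟨y, hy0, hy⟩ := hB.exists_vanishing_moments
  set A := revMatrix (2 * g + 1) ℚ with hA
  set T := A * B with hT
  have hAA : A * A = 1 := revMatrix_mul_self (2 * g + 1) ℚ
  have hAt : Aᵀ = A := revMatrix_transpose (2 * g + 1) ℚ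
  have hAT : A * T = B := by rw [hT, ← mul_assoc, hAA, one_mul]
  have hATt : (A * T)ᵀ = A * T := by rw [hAT]; exact hB.1
  have hsep : T.charpoly.Separable := charpoly_separable_of_matDisc_ne_zero (by omega) hB.2.1
  let Ω := AlgebraicClosure ℚ
  let φ : ℚ →+* Ω := algebraMap ℚ Ω
  have hφ : Function.Injective φ := φ.injective
  set AΩ := revMatrix (2 * g + 1) Ω with hAΩ
  have hAΩm : A.map φ = AΩ := revMatrix_map (2 * g + 1) φ
  set TΩ := AΩ * B.map φ with hTΩ
  have hTm : T.map φ = TΩ := by rw [hT, Matrix.map_mul, hAΩm]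
  have hAAΩ : AΩ * AΩ = 1 := revMatrix_mul_self (2 * g + 1) Ω
  have hAtΩ : AΩᵀ = AΩ := revMatrix_transpose (2 * g + 1) Ω
  have hATΩt : (AΩ * TΩ)ᵀ = AΩ * TΩ := by
    rw [← hAΩm, ← hTm, ← Matrix.map_mul, ← Matrix.transpose_map, hATt]
  have hmom : ∀ k : ℕ, (φ ∘ y) ⬝ᵥ (AΩ *ᵥ (TΩ ^ k *ᵥ (φ ∘ y))) = φ (y ⬝ᵥ (A *ᵥ (T ^ k *ᵥ y))) := by
    intro k
    have hTk : (T ^ k).map φ = TΩ ^ k := by rw [← hTm]; exact map_pow φ.mapMatrix T k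
    rw [RingHom.map_dotProduct, ← hTk, ← hAΩm]
    congr 1
    ext i
    rw [Function.comp_apply, RingHom.map_mulVec]
    congr 2
    ext j
    rw [Function.comp_apply, RingHom.map_mulVec]
  obtain ⟨l, Q, hl, hroot, hQ, hTQ⟩ := Matrix.exists_eigenbasis (T := TΩ)
    (by rw [← hTm, Matrix.charpoly_map]; exact hsep.map)
  set κ := y ⬝ᵥ (A *ᵥ (T ^ (2 * g) *ᵥ y)) with hκ
  have hκ0 : κ ≠ 0 := by
    intro h
    apply hy0
    have hz : φ ∘ y = 0 := by
      refine eq_zero_of_moments_eq_zero hAtΩ (IsUnit.of_mul_eq_one _ hAAΩ) hATΩt hl hQ hTQ ?_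
      intro k hk
      rw [hmom]
      rcases Nat.lt_succ_iff_lt_or_eq.mp hk with hk | rfl
      · rw [hy k hk, map_zero]
      · rw [← hκ, h, map_zero]
    ext i
    exact hφ (by simpa using congrFun hz i)
  obtain ⟨h, hh⟩ := exists_aeval_mulVec_eq hy hκ0 (1 : Fin (2 * g + 1) → ℚ)
  have hhm : (Polynomial.aeval T h).map φ = Polynomial.aeval TΩ (h.map φ) := by
    rw [← hTm]
    exact Polynomial.map_aeval_eq_aeval_map (φ := φ) (ψ := φ.mapMatrix (m := Fin (2 * g + 1)))
      (by ext r i j; simp [Matrix.algebraMap_matrix_apply]) h T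
  have hhΩ : Polynomial.aeval TΩ (h.map φ) *ᵥ (φ ∘ y) = 1 := by
    rw [← hhm]
    ext i
    rw [← RingHom.map_mulVec, hh]
    simp
  have hβ : ∀ i, (componentPoly AΩ TΩ 1).eval (l i) = (h.map φ).eval (l i) ^ 2 * φ κ := by
    intro i
    have h1 := eval_componentPoly_of_moments (m := 2 * g) hAtΩ hATΩt (y := φ ∘ y)
      (fun k hk => by rw [hmom, hy k hk, map_zero]) (h.map φ) (hroot i)
    rw [hhΩ, hmom] at h1
    exact h1
  obtain ⟨s, hs⟩ := IsAlgClosed.exists_pow_nat_eq (φ κ) two_pos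
  have hprod := pencilResolvent_map_eq_signProd (B := B.map φ) ⟨g, rfl⟩ (RingHom.id Ω) hQ hTQ
    (fun i => (h.map φ).eval (l i) * s) (fun i => by
      rw [mul_pow, hs]; exact (hβ i).symm)
  rw [Polynomial.map_id] at hprod
  have htr : ∑ i, (h.map φ).eval (l i) = φ (Polynomial.aeval T h).trace := by
    have h1 : φ (Polynomial.aeval T h).trace = (Polynomial.aeval TΩ (h.map φ)).trace := by
      rw [← hhm, AddMonoidHom.map_trace]
    obtain ⟨u, rfl⟩ := hQ
    have h2 := aeval_mul_of_intertwine hTQ (h.map φ)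
    have h3 : Polynomial.aeval TΩ (h.map φ) = (u : Matrix (Fin (2 * g + 1)) (Fin (2 * g + 1)) Ω) *
        ((Matrix.diagonal fun i => (h.map φ).eval (l i)) *
          (↑u⁻¹ : Matrix (Fin (2 * g + 1)) (Fin (2 * g + 1)) Ω)) := by
      rw [← mul_assoc, ← h2, mul_assoc, Units.mul_inv, mul_one]
    rw [h1, h3, Matrix.trace_mul_comm, mul_assoc, Units.inv_mul, mul_one, Matrix.trace_diagonal]
  refine ⟨κ * (Polynomial.aeval T h).trace ^ 2, ?_⟩
  rw [← Polynomial.isRoot_map_iff hφ, pencilResolvent_map, hprod, Polynomial.IsRoot, signProd,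
    Polynomial.eval_prod]
  refine Finset.prod_eq_zero (i := 0) (by simp [mem_evenPatterns]) ?_
  simp only [Pi.zero_apply, zmodSign_zero, Int.cast_one, one_mul, ← Finset.sum_mul, htr]
  rw [Polynomial.eval_sub, Polynomial.eval_X, Polynomial.eval_C, map_mul, map_pow, mul_pow, hs]
  ring

/-! ### Independent square roots -/

/-- Kummer theory for exponent two: if no nonempty product of the square roots `rᵢ` lies in the
base field, then every choice of signs is realised by an automorphism. Otherwise the realised sign
patterns lie in the kernel of a nonzero linear form over `ZMod 2`, and the product of the `rᵢ`
over the support of that form is fixed by all automorphisms. -/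
lemma exists_algEquiv_sign {S E ι : Type*} [Field S] [Field E] [Algebra S E] [IsGalois S E]
    [Fintype ι] (r : ι → E) (hr : ∀ i, ∃ d : S, r i ^ 2 = algebraMap S E d)
    (hind : ∀ I : Finset ι, I.Nonempty → ∏ i ∈ I, r i ∉ Set.range (algebraMap S E))
    (v : ι → ZMod 2) :
    ∃ σ : E ≃ₐ[S] E, ∀ i, σ (r i) = (zmodSign (v i) : E) * r i := by
  classical
  let V₀ : AddSubgroup (ι → ZMod 2) :=
    { carrier := {u | ∃ σ : E ≃ₐ[S] E, ∀ i, σ (r i) = (zmodSign (u i) : E) * r i}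
      zero_mem' := ⟨AlgEquiv.refl, fun i => by simp⟩
      add_mem' := by
        rintro u u' ⟨σ, hσ⟩ ⟨τ, hτ⟩
        refine ⟨τ.trans σ, fun i => ?_⟩
        rw [AlgEquiv.trans_apply, hτ, map_mul, map_intCast, hσ, Pi.add_apply, zmodSign_add]
        push_cast
        ring
      neg_mem' := by
        intro u hu
        have : -u = u := by ext i; simp [CharTwo.neg_eq]
        rwa [this] }
  let V : Submodule (ZMod 2) (ι → ZMod 2) := AddSubgroup.toZModSubmodule 2 V₀
  have hV : ∀ u, u ∈ V ↔ ∃ σ : E ≃ₐ[S] E, ∀ i, σ (r i) = (zmodSign (u i) : E) * r i :=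
    fun _ => Iff.rfl
  rw [← hV]
  by_contra hv
  obtain ⟨φ, hφv, hφV⟩ := Submodule.exists_le_ker_of_notMem hv
  set I : Finset ι := Finset.univ.filter fun i => φ (Pi.single i 1) ≠ 0 with hI
  have hφ : ∀ u, φ u = ∑ i ∈ I, u i := by
    intro u
    rw [LinearMap.pi_apply_eq_sum_univ φ u, hI, Finset.sum_filter]
    refine Finset.sum_congr rfl fun i _ => ?_
    have h01 : ∀ a b : ZMod 2, a • b = if b ≠ 0 then a else 0 := by decide
    have hs : (fun j => if i = j then (1 : ZMod 2) else 0) = Pi.single i 1 := by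
      ext j; simp [Pi.single_apply, eq_comm]
    rw [hs, h01]
  have hIne : I.Nonempty := by
    rw [Finset.nonempty_iff_ne_empty]
    intro h
    exact hφv (by rw [hφ, h, Finset.sum_empty])
  refine hind I hIne ((InfiniteGalois.mem_range_algebraMap_iff_fixed _).mpr fun σ => ?_)
  have hσ : ∀ i, ∃ a : ZMod 2, σ (r i) = (zmodSign a : E) * r i := by
    intro i
    obtain ⟨d, hd⟩ := hr i
    have h1 : σ (r i) ^ 2 = r i ^ 2 := by rw [← map_pow, hd, AlgEquiv.commutes]
    rcases sq_eq_sq_iff_eq_or_eq_neg.mp h1 with h | h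
    · exact ⟨0, by simpa using h⟩
    · exact ⟨1, by simpa using h⟩
  choose u hu using hσ
  have hker : φ u = 0 := LinearMap.mem_ker.mp (hφV ((hV u).mpr ⟨σ, hu⟩))
  rw [hφ] at hker
  rw [map_prod, Finset.prod_congr rfl fun i _ => hu i, Finset.prod_mul_distrib, ← Int.cast_prod,
    ← zmodSign_sum, hker]
  simp

section SignConjugates

variable {S E : Type*} [Field S] [Field E] [Algebra S E] {g : ℕ} {r : Fin (2 * g + 1) → E}

/-- If all even sign patterns are realised by automorphisms, the square roots are linearly
independent. -/
lemma int_combination_eq_zero [CharZero E] (hr0 : ∀ i, r i ≠ 0)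
    (hσ : ∀ v ∈ evenPatterns (2 * g + 1), ∃ σ : E ≃ₐ[S] E,
      ∀ i, σ (r i) = (zmodSign (v i) : E) * r i)
    (a : Fin (2 * g + 1) → ℤ) (ha : ∑ i, (a i : E) * r i = 0) : a = 0 := by
  -- flipping the signs at `k` and `j` isolates two terms of the relation
  have hpair : ∀ k j, k ≠ j → (a k : E) * r k + a j * r j = 0 := by
    intro k j hkj
    obtain ⟨σ, hσ'⟩ := hσ (Pi.single k 1 + Pi.single j 1) (by
      rw [mem_evenPatterns]
      simp only [Pi.add_apply, Finset.sum_add_distrib, Finset.sum_pi_single', Finset.mem_univ,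
        if_true]
      decide)
    have h1 := congrArg σ ha
    rw [map_sum, map_zero] at h1
    have h2 : ∀ i, σ ((a i : E) * r i) =
        a i * r i - 2 * ((if i = k then (a k : E) * r k else 0) +
          if i = j then (a j : E) * r j else 0) := by
      intro i
      rw [map_mul, map_intCast, hσ' i, Pi.add_apply, zmodSign_add]
      by_cases hik : i = k
      · subst hik
        simp [hkj]
        ring
      · by_cases hij : i = j
        · subst hij
          simp [hik]
          ring
        · simp [hik, hij]
    simp only [h2, Finset.sum_sub_distrib, ← Finset.mul_sum, Finset.sum_add_distrib, ha,
      Finset.sum_ite_eq', Finset.mem_univ, if_true, zero_sub, neg_eq_zero] at h1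
    exact (mul_eq_zero.mp h1).resolve_left two_ne_zero
  have hterm : ∀ k, (a k : E) * r k = 0 := by
    intro k
    rcases Nat.eq_zero_or_pos g with rfl | hg
    · rw [Fintype.sum_eq_single k fun i hi => absurd (Subsingleton.elim (α := Fin 1) i k) hi] at ha
      exact ha
    · obtain ⟨j, hj⟩ : ∃ j, j ∉ ({k} : Finset (Fin (2 * g + 1))) := by
        by_contra hcon
        push Not at hcon
        have := Finset.card_le_card (fun x _ => hcon x : Finset.univ ⊆ ({k} : Finset _))
        simp at this
        omega
      obtain ⟨i, hi⟩ : ∃ i, i ∉ ({k, j} : Finset (Fin (2 * g + 1))) := by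
        by_contra hcon
        push Not at hcon
        have := (Finset.card_le_card (fun x _ => hcon x : Finset.univ ⊆ ({k, j} : Finset _))).trans
          Finset.card_le_two
        simp at this
        omega
      simp only [Finset.mem_singleton, Finset.mem_insert, not_or] at hi hj
      have h1 := hpair k j (Ne.symm hj)
      have h2 := hpair k i (Ne.symm hi.1)
      have h3 := hpair j i (Ne.symm hi.2)
      have : 2 * ((a k : E) * r k) = 0 := by linear_combination h1 + h2 - h3
      exact (mul_eq_zero.mp this).resolve_left two_ne_zero
  ext k
  have := (mul_eq_zero.mp (hterm k)).resolve_right (hr0 k)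
  exact_mod_cast this

lemma sum_sign_sq_injOn [CharZero E] (hr0 : ∀ i, r i ≠ 0)
    (hσ : ∀ v ∈ evenPatterns (2 * g + 1), ∃ σ : E ≃ₐ[S] E,
      ∀ i, σ (r i) = (zmodSign (v i) : E) * r i) :
    Set.InjOn (fun v : Fin (2 * g + 1) → ZMod 2 => (∑ i, (zmodSign (v i) : E) * r i) ^ 2)
      (evenPatterns (2 * g + 1)) := by
  intro u hu v hv huv
  rw [Finset.mem_coe] at hu hv
  rcases sq_eq_sq_iff_eq_or_eq_neg.mp huv with h | h
  · have := int_combination_eq_zero hr0 hσ (fun i => zmodSign (u i) - zmodSign (v i)) (by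
      push_cast
      simp only [sub_mul, Finset.sum_sub_distrib, h, sub_self])
    ext1 i
    exact zmodSign_injective (sub_eq_zero.mp (congrFun this i))
  · have := int_combination_eq_zero hr0 hσ (fun i => zmodSign (u i) + zmodSign (v i)) (by
      push_cast
      simp only [add_mul, Finset.sum_add_distrib, h, neg_add_cancel])
    have h1 : ∏ i, zmodSign (u i) = 1 := by
      rw [← zmodSign_sum, mem_evenPatterns.mp hu, zmodSign_zero]
    have h2 : ∏ i, zmodSign (v i) = 1 := by
      rw [← zmodSign_sum, mem_evenPatterns.mp hv, zmodSign_zero]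
    have h3 : ∀ i, zmodSign (u i) = -1 * zmodSign (v i) := fun i => by
      have := congrFun this i
      simp only [Pi.zero_apply] at this
      omega
    rw [Finset.prod_congr rfl fun i _ => h3 i, Finset.prod_mul_distrib, h2] at h1
    simp [pow_succ, pow_mul] at h1

/-- If all even sign patterns are realised by automorphisms, `∏ (X - (∑ ± rᵢ)²)` is the minimal
polynomial of `(∑ rᵢ)²`. -/
lemma irreducible_of_map_eq_signProd [CharZero E] (hr0 : ∀ i, r i ≠ 0)
    (hσ : ∀ v ∈ evenPatterns (2 * g + 1), ∃ σ : E ≃ₐ[S] E,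
      ∀ i, σ (r i) = (zmodSign (v i) : E) * r i)
    {F : Polynomial S} (hF : F.map (algebraMap S E) = signProd r) (hFm : F.Monic) :
    Irreducible F := by
  classical
  set θ : E := (∑ i, r i) ^ 2 with hθ
  have hroot : Polynomial.aeval θ F = 0 := by
    rw [Polynomial.aeval_def, ← Polynomial.eval_map, hF, signProd, Polynomial.eval_prod]
    refine Finset.prod_eq_zero (i := 0) (by simp [mem_evenPatterns]) ?_
    rw [Polynomial.eval_sub, Polynomial.eval_X, Polynomial.eval_C, hθ]
    simp
  have hint : IsIntegral S θ := ⟨F, hFm, hroot⟩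
  have hdvd := minpoly.dvd S θ hroot
  have hm0 : (minpoly S θ).map (algebraMap S E) ≠ 0 :=
    ((minpoly.monic hint).map (algebraMap S E)).ne_zero
  have hsub : (evenPatterns (2 * g + 1)).image
      (fun v => (∑ i, (zmodSign (v i) : E) * r i) ^ 2) ⊆
      ((minpoly S θ).map (algebraMap S E)).roots.toFinset := by
    intro x hx
    obtain ⟨v, hv, rfl⟩ := Finset.mem_image.mp hx
    obtain ⟨σ, hσv⟩ := hσ v hv
    have hx' : (∑ i, (zmodSign (v i) : E) * r i) ^ 2 = σ θ := by
      rw [hθ, map_pow, map_sum]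
      simp only [hσv]
    rw [Multiset.mem_toFinset, Polynomial.mem_roots hm0, Polynomial.IsRoot, Polynomial.eval_map,
      hx', ← Polynomial.aeval_def]
    have := Polynomial.aeval_algHom_apply σ.toAlgHom θ (minpoly S θ)
    rw [minpoly.aeval, map_zero] at this
    exact this
  have hcard := (Finset.card_le_card hsub).trans (Multiset.toFinset_card_le _)
  rw [Finset.card_image_of_injOn (sum_sign_sq_injOn hr0 hσ), card_evenPatterns] at hcard
  have hdeg := hcard.trans (Polynomial.card_roots' _)
  rw [Polynomial.natDegree_map] at hdeg
  have hFdeg : F.natDegree = 2 ^ (2 * g) := by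
    rw [← Polynomial.natDegree_map (algebraMap S E), hF, signProd_natDegree]
  have heq := Polynomial.eq_of_monic_of_dvd_of_natDegree_le (minpoly.monic hint) hFm hdvd
    (by omega)
  rw [heq]
  exact minpoly.irreducible hint

/-- Even sign patterns are already realised if the product of all `rᵢ`, but no nonempty product
of `rᵢ` avoiding the last one, lies in the base field. -/
lemma exists_algEquiv_evenPattern [IsGalois S E] (hr0 : ∀ i, r i ≠ 0)
    (hr : ∀ i, ∃ d : S, r i ^ 2 = algebraMap S E d)
    (hprod : ∏ i, r i ∈ Set.range (algebraMap S E))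
    (hind : ∀ I : Finset (Fin (2 * g)), I.Nonempty →
      ∏ i ∈ I, r i.castSucc ∉ Set.range (algebraMap S E))
    {v : Fin (2 * g + 1) → ZMod 2} (hv : v ∈ evenPatterns (2 * g + 1)) :
    ∃ σ : E ≃ₐ[S] E, ∀ i, σ (r i) = (zmodSign (v i) : E) * r i := by
  obtain ⟨σ, hσ⟩ := exists_algEquiv_sign (fun i : Fin (2 * g) => r i.castSucc)
    (fun i => hr _) hind (fun i => v i.castSucc)
  refine ⟨σ, Fin.lastCases ?_ hσ⟩
  obtain ⟨z, hz⟩ := hprod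
  have h1 := congrArg σ hz
  rw [AlgEquiv.commutes, hz, Fin.prod_univ_castSucc, map_mul, map_prod,
    Finset.prod_congr rfl fun i _ => hσ i, Finset.prod_mul_distrib, ← Int.cast_prod,
    ← zmodSign_sum] at h1
  rw [mem_evenPatterns, Fin.sum_univ_castSucc, CharTwo.add_eq_zero] at hv
  rw [hv] at h1
  have hP : ∏ i : Fin (2 * g), r i.castSucc ≠ 0 := Finset.prod_ne_zero_iff.mpr fun i _ => hr0 _
  have h2 : r (Fin.last _) = (zmodSign (v (Fin.last _)) : E) * σ (r (Fin.last _)) :=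
    mul_left_cancel₀ hP (by rw [h1]; ring)
  conv_rhs => rw [h2]
  rcases zmodSign_eq_one_or (v (Fin.last _)) with h | h <;> simp [h]

end SignConjugates

/-! ### A specialization with independent square roots -/

section OrthonormalPencil

variable {n : ℕ} {K : Type*} [Field K]

/-- For `I² = -1`, a symmetric square root of `A₀`. -/
noncomputable def revRoot (n : ℕ) {K : Type*} [Field K] (I : K) : Matrix (Fin n) (Fin n) K :=
  (1 + I)⁻¹ • (1 + I • revMatrix n K)

lemma revRoot_transpose (I : K) : (revRoot n I)ᵀ = revRoot n I := by
  simp [revRoot, Matrix.transpose_add, Matrix.transpose_smul, revMatrix_transpose]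

lemma one_add_ne_zero_of_sq [CharZero K] {I : K} (hI : I ^ 2 = -1) : 1 + I ≠ 0 := by
  intro h
  have h1 : I = -1 := by linear_combination h
  rw [h1] at hI
  norm_num at hI

lemma revRoot_mul_self [CharZero K] {I : K} (hI : I ^ 2 = -1) :
    revRoot n I * revRoot n I = revMatrix n K := by
  have h0 := one_add_ne_zero_of_sq hI
  have h1 : (1 + I • revMatrix n K) * (1 + I • revMatrix n K) =
      (1 + I) ^ 2 • revMatrix n K := by
    have hI2 : (1 + I) ^ 2 = 2 * I := by linear_combination hI
    rw [hI2, mul_add, add_mul, add_mul, smul_mul_smul_comm, revMatrix_mul_self, ← pow_two I, hI]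
    simp only [mul_one, one_mul, neg_smul, one_smul, two_mul, add_smul]
    abel
  rw [revRoot, smul_mul_smul_comm, h1, smul_smul]
  have : (1 + I)⁻¹ * (1 + I)⁻¹ * (1 + I) ^ 2 = 1 := by field_simp
  rw [this, one_smul]

lemma revRoot_mulVec_one [CharZero K] {I : K} (hI : I ^ 2 = -1) :
    revRoot n I *ᵥ (1 : Fin n → K) = 1 := by
  have h0 := one_add_ne_zero_of_sq hI
  ext i
  rw [revRoot, Matrix.smul_mulVec, Matrix.add_mulVec, Matrix.smul_mulVec, Matrix.one_mulVec]
  simp [revMatrix_mulVec, h0]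

/-- The symmetric matrix whose pencil with `A₀` has the columns of `(√A₀)³` as an orthonormal
eigenbasis, with the `lᵢ` as eigenvalues. -/
noncomputable def orthonormalPencil (I : K) (l : Fin n → K) : Matrix (Fin n) (Fin n) K :=
  revRoot n I * Matrix.diagonal l * revRoot n I

lemma orthonormalPencil_transpose (I : K) (l : Fin n → K) :
    (orthonormalPencil I l)ᵀ = orthonormalPencil I l := by
  simp [orthonormalPencil, Matrix.transpose_mul, revRoot_transpose, mul_assoc]

lemma revRoot_pow_four [CharZero K] {I : K} (hI : I ^ 2 = -1) : revRoot n I ^ 4 = 1 := by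
  rw [show 4 = 2 * 2 from rfl, pow_mul, pow_two (revRoot n I), revRoot_mul_self hI, pow_two,
    revMatrix_mul_self]

lemma orthonormalPencil_intertwine [CharZero K] {I : K} (hI : I ^ 2 = -1) (l : Fin n → K) :
    revMatrix n K * orthonormalPencil I l * revRoot n I ^ 3 =
      revRoot n I ^ 3 * Matrix.diagonal l := by
  have h4 := revRoot_pow_four (n := n) hI
  have h : revMatrix n K * orthonormalPencil I l * revRoot n I ^ 3 =
      revRoot n I ^ 3 * Matrix.diagonal l * revRoot n I ^ 4 := by
    rw [← revRoot_mul_self hI, orthonormalPencil]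
    noncomm_ring
  rw [h, h4, mul_one]

lemma isUnit_revRoot_pow [CharZero K] {I : K} (hI : I ^ 2 = -1) : IsUnit (revRoot n I ^ 3) :=
  IsUnit.of_mul_eq_one (revRoot n I) (by rw [← pow_succ]; exact revRoot_pow_four hI)

/-- The product `∏ (lᵢ - lⱼ)` over `j ≠ i`. -/
def diffProd {R : Type*} [CommRing R] (l : Fin n → R) (i : Fin n) : R :=
  ∏ j, if j = i then 1 else l i - l j

/-- In the orthonormal pencil all components of the all-ones vector have square `1`, so that
`β(lᵢ) = f'(lᵢ)`. -/
lemma eval_componentPoly_orthonormalPencil {m : ℕ} [CharZero K] {I : K} (hI : I ^ 2 = -1)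
    (l : Fin (m + 1) → K) (i : Fin (m + 1)) :
    (componentPoly (revMatrix _ K) (revMatrix _ K * orthonormalPencil I l) 1).eval (l i) =
      diffProd l i := by
  have hTQ := orthonormalPencil_intertwine hI l
  have hQ := isUnit_revRoot_pow (n := m + 1) hI
  set T := revMatrix _ K * orthonormalPencil I l with hT
  set q := ∏ j ∈ Finset.univ.erase i, (Polynomial.X - Polynomial.C (l j)) with hq
  have hchar : T.charpoly = ∏ j, (Polynomial.X - Polynomial.C (l j)) := by
    have := charpoly_aeval_of_intertwine hQ hTQ Polynomial.X
    simpa using this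
  have hdiv : T.charpoly /ₘ (Polynomial.X - Polynomial.C (l i)) = q := by
    rw [hchar, ← Finset.mul_prod_erase _ _ (Finset.mem_univ i),
      Polynomial.mul_divByMonic_cancel_left _ (Polynomial.monic_X_sub_C _)]
  have hP1 := revRoot_mulVec_one (n := m + 1) hI
  have hQ1 : revRoot (m + 1) I ^ 3 *ᵥ (1 : Fin (m + 1) → K) = 1 := by
    rw [pow_succ, pow_two, ← Matrix.mulVec_mulVec, ← Matrix.mulVec_mulVec, hP1, hP1, hP1]
  have h5 : revMatrix (m + 1) K * revRoot (m + 1) I ^ 3 = revRoot (m + 1) I := by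
    rw [← revRoot_mul_self hI, ← pow_two, ← pow_add, show 2 + 3 = 4 + 1 from rfl, pow_succ,
      revRoot_pow_four hI, one_mul]
  have h1 : Polynomial.aeval T q *ᵥ (1 : Fin (m + 1) → K) =
      revRoot (m + 1) I ^ 3 *ᵥ (fun j => q.eval (l j)) := by
    conv_lhs => rw [← hQ1]
    rw [Matrix.mulVec_mulVec, aeval_mul_of_intertwine hTQ, ← Matrix.mulVec_mulVec]
    congr 1
    ext j
    rw [Matrix.mulVec_diagonal, Pi.one_apply, mul_one]
  rw [eval_componentPoly, hdiv, h1, Matrix.mulVec_mulVec, h5, Matrix.dotProduct_mulVec,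
    ← Matrix.mulVec_transpose, revRoot_transpose, hP1, dotProduct, Finset.sum_eq_single i]
  · rw [Pi.one_apply, one_mul, hq, Polynomial.eval_prod, diffProd,
      ← Finset.mul_prod_erase _ _ (Finset.mem_univ i), if_pos rfl, one_mul]
    refine Finset.prod_congr rfl fun j hj => ?_
    rw [if_neg (Finset.ne_of_mem_erase hj)]
    simp
  · intro j _ hji
    rw [hq, Polynomial.eval_prod, Finset.prod_eq_zero (Finset.mem_erase.mpr
      ⟨hji, Finset.mem_univ j⟩) (by simp), mul_zero]
  · simp

lemma exists_prod_diffProd_eq_sq {I : K} (hI : I ^ 2 = -1) (l : Fin n → K) :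
    ∃ z, ∏ i, diffProd l i = z ^ 2 := by
  refine ⟨∏ i, ∏ j, if i < j then I * (l i - l j) else 1, ?_⟩
  have h1 : ∀ i j : Fin n, (if j = i then (1 : K) else l i - l j) =
      (if i < j then l i - l j else 1) * (if j < i then l i - l j else 1) := by
    intro i j
    rcases lt_trichotomy i j with h | rfl | h
    · simp [h, h.ne', h.le]
    · simp
    · simp [h, h.ne, h.le]
  simp only [diffProd, h1, Finset.prod_mul_distrib]
  rw [Finset.prod_comm (f := fun i j => if j < i then l i - l j else 1), pow_two]
  simp only [← Finset.prod_mul_distrib]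
  refine Finset.prod_congr rfl fun i _ => Finset.prod_congr rfl fun j _ => ?_
  split_ifs
  · linear_combination (-(l i - l j) ^ 2) * hI
  · rfl

end OrthonormalPencil

open Polynomial in
/-- With the eigenvalues `0, …, m - 1` and `t`, the product of the `f'(i)` over a nonempty set of
indices `i < m` is a constant times a product of distinct linear factors in `t`, hence not a
square. -/
lemma prod_diffProd_ne_sq {k : Type*} [Field k] [CharZero k] {m : ℕ} (I : Finset (Fin m))
    (hI : I.Nonempty) (p : k[X]) :
    p ^ 2 ≠ ∏ i ∈ I, diffProd
      (Fin.snoc (α := fun _ => k[X]) (fun j : Fin m => C ((j : ℕ) : k)) X) i.castSucc := by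
  set L : Fin (m + 1) → k[X] :=
    Fin.snoc (α := fun _ => k[X]) (fun j : Fin m => C ((j : ℕ) : k)) X with hL
  intro hp
  set c : Fin m → k := fun i => ∏ j : Fin m, if j = i then 1 else ((i : ℕ) : k) - ((j : ℕ) : k)
    with hc
  have hc0 : ∀ i, c i ≠ 0 := by
    intro i
    refine Finset.prod_ne_zero_iff.mpr fun j _ => ?_
    split_ifs with h
    · exact one_ne_zero
    · rw [sub_ne_zero]
      exact fun h' => h (Fin.ext (Nat.cast_injective h')).symm
  have hd : ∀ i : Fin m, diffProd L i.castSucc = C (-c i) * (X - C ((i : ℕ) : k)) := by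
    intro i
    have hne : Fin.last m ≠ i.castSucc := (Fin.castSucc_lt_last i).ne'
    rw [diffProd, Fin.prod_univ_castSucc, if_neg hne]
    simp only [hL, Fin.snoc_castSucc, Fin.snoc_last, Fin.castSucc_inj]
    have : (∏ x : Fin m, if x = i then (1 : k[X]) else C ((i : ℕ) : k) - C ((x : ℕ) : k)) =
        C (c i) := by
      rw [hc, map_prod]
      refine Finset.prod_congr rfl fun j _ => ?_
      split_ifs <;> simp
    rw [this, C_neg]
    ring
  rw [Finset.prod_congr rfl fun i _ => hd i, Finset.prod_mul_distrib, ← map_prod] at hp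
  have hunit : IsUnit (C (∏ i ∈ I, -c i)) :=
    isUnit_C.mpr (IsUnit.mk0 _ (Finset.prod_ne_zero_iff.mpr fun i _ => neg_ne_zero.mpr (hc0 i)))
  have hsep : (∏ i ∈ I, (X - C ((i : ℕ) : k))).Separable :=
    separable_prod_X_sub_C_iff'.mpr fun i _ j _ h => Fin.ext (Nat.cast_injective h)
  have hpu : IsUnit p := by
    refine isUnit_of_self_mul_dvd_separable hsep ?_
    rw [← pow_two, hp]
    exact (hunit.dvd_mul_left.mp dvd_rfl)
  have hu : IsUnit (∏ i ∈ I, (X - C ((i : ℕ) : k))) :=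
    isUnit_of_mul_isUnit_right (hp ▸ hpu.pow 2)
  obtain ⟨i, hi⟩ := hI
  exact not_isUnit_X_sub_C ((i : ℕ) : k) (isUnit_of_dvd_unit
    (Finset.dvd_prod_of_mem (fun i : Fin m => X - C ((i : ℕ) : k)) hi) hu)

open Polynomial in
/-- Over `k(t)` with `√-1 ∈ k`, the resolvent of the orthonormal pencil with eigenvalues
`0, …, 2g - 1, t` is irreducible. -/
lemma irreducible_pencilResolvent_orthonormalPencil {k : Type*} [Field k] [CharZero k] {J : k}
    (hJ : J ^ 2 = -1) (g : ℕ) :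
    Irreducible (pencilResolvent (orthonormalPencil
      (algebraMap k[X] (FractionRing k[X]) (C J))
      (fun i => algebraMap k[X] (FractionRing k[X]) (Fin.snoc (α := fun _ => k[X])
        (fun j : Fin (2 * g) => C ((j : ℕ) : k)) X i)))) := by
  set S := FractionRing k[X] with hS
  set L : Fin (2 * g + 1) → k[X] :=
    Fin.snoc (α := fun _ => k[X]) (fun j : Fin (2 * g) => C ((j : ℕ) : k)) X with hL
  set I : S := algebraMap k[X] S (C J) with hI
  have hI2 : I ^ 2 = -1 := by
    rw [hI, ← map_pow, ← map_pow, hJ]; simp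
  have : CharZero S :=
    charZero_of_injective_algebraMap (IsFractionRing.injective k[X] S)
  set l : Fin (2 * g + 1) → S := fun i => algebraMap k[X] S (L i) with hl
  have hLinj : Function.Injective L := by
    intro i j
    refine Fin.lastCases ?_ (fun i => ?_) i <;> refine Fin.lastCases ?_ (fun j => ?_) j
    · simp
    · simp only [hL, Fin.snoc_last, Fin.snoc_castSucc]
      intro h
      exact absurd h (X_ne_C _)
    · simp only [hL, Fin.snoc_last, Fin.snoc_castSucc]
      intro h
      exact absurd h.symm (X_ne_C _)
    · simp only [hL, Fin.snoc_castSucc, C_inj]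
      intro h
      rw [Fin.ext (Nat.cast_injective h)]
  have hd : ∀ i, diffProd l i = algebraMap k[X] S (diffProd L i) := by
    intro i
    rw [diffProd, diffProd, map_prod]
    refine Finset.prod_congr rfl fun j _ => ?_
    split_ifs <;> simp [hl]
  have hd0 : ∀ i, diffProd l i ≠ 0 := by
    intro i
    refine Finset.prod_ne_zero_iff.mpr fun j _ => ?_
    split_ifs with h
    · exact one_ne_zero
    · rw [sub_ne_zero]
      exact fun h' => h (hLinj (IsFractionRing.injective k[X] S h')).symm
  let E := AlgebraicClosure S
  have hsqrt : ∀ i, ∃ r : E, r ^ 2 = algebraMap S E (diffProd l i) := fun i =>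
    IsAlgClosed.exists_pow_nat_eq _ two_pos
  choose r hr using hsqrt
  have hr0 : ∀ i, r i ≠ 0 := by
    intro i h
    have := hr i
    rw [h, zero_pow two_ne_zero] at this
    exact hd0 i ((map_eq_zero (algebraMap S E)).mp this.symm)
  have : CharZero E := charZero_of_injective_algebraMap (algebraMap S E).injective
  have hprod : ∏ i, r i ∈ Set.range (algebraMap S E) := by
    obtain ⟨z, hz⟩ := exists_prod_diffProd_eq_sq hI2 l
    have h1 : (∏ i, r i) ^ 2 = (algebraMap S E z) ^ 2 := by
      rw [← Finset.prod_pow, Finset.prod_congr rfl fun i _ => hr i, ← map_prod, hz, map_pow]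
    rcases sq_eq_sq_iff_eq_or_eq_neg.mp h1 with h | h
    · exact ⟨z, h.symm⟩
    · exact ⟨-z, by rw [map_neg, h]⟩
  have hind : ∀ U : Finset (Fin (2 * g)), U.Nonempty →
      ∏ i ∈ U, r i.castSucc ∉ Set.range (algebraMap S E) := by
    rintro U hU ⟨z, hz⟩
    have h1 : z ^ 2 = algebraMap k[X] S (∏ i ∈ U, diffProd L i.castSucc) := by
      apply (algebraMap S E).injective
      rw [map_pow, hz, ← Finset.prod_pow, Finset.prod_congr rfl fun i _ => hr _, map_prod,
        map_prod]
      simp only [hd]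
    obtain ⟨p, hp⟩ := IsIntegrallyClosed.exists_algebraMap_eq_of_isIntegral_pow
      (R := k[X]) (x := z) two_pos (h1 ▸ isIntegral_algebraMap)
    rw [← hp, ← map_pow] at h1
    exact prod_diffProd_ne_sq U hU p (IsFractionRing.injective k[X] S h1)
  refine irreducible_of_map_eq_signProd (E := E) hr0
    (fun v hv => exists_algEquiv_evenPattern hr0 (fun i => ⟨_, hr i⟩) hprod hind hv) ?_
    (pencilResolvent_monic _)
  refine pencilResolvent_map_eq_signProd ⟨g, rfl⟩ _ (isUnit_revRoot_pow hI2)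
    (orthonormalPencil_intertwine hI2 l) r fun i => ?_
  rw [eval_componentPoly_orthonormalPencil hI2, hr]

/-! ### The generic symmetric matrix -/

/-- The generic symmetric matrix with independent entries `b_ij`, `i ≤ j`. -/
noncomputable def genericSymm (n : ℕ) (R : Type*) [CommRing R] :
    Matrix (Fin n) (Fin n) (MvPolynomial (SymIndex n) R) :=
  Matrix.of fun i j => MvPolynomial.X ⟨(min i j, max i j), min_le_max⟩

lemma genericSymm_map_eval₂Hom {n : ℕ} {R S : Type*} [CommRing R] [CommRing S] (φ : R →+* S)
    {B : Matrix (Fin n) (Fin n) S} (hB : Bᵀ = B) :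
    (genericSymm n R).map (MvPolynomial.eval₂Hom φ fun p : SymIndex n => B p.1.1 p.1.2) = B := by
  ext i j
  simp only [genericSymm, Matrix.map_apply, Matrix.of_apply, MvPolynomial.coe_eval₂Hom,
    MvPolynomial.eval₂_X]
  rcases le_total i j with h | h
  · rw [min_eq_left h, max_eq_right h]
  · rw [min_eq_right h, max_eq_left h]
    exact congrFun (congrFun hB i) j

lemma genericSymm_map_map {n : ℕ} {R S : Type*} [CommRing R] [CommRing S] (φ : R →+* S) :
    (genericSymm n R).map (MvPolynomial.map φ) = genericSymm n S := by
  ext1 i j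
  simp [genericSymm]

lemma exists_gaussianRat_sq_eq_neg_one : ∃ J : GaussianRat, J ^ 2 = -1 := by
  refine ⟨algebraMap GaussianInt GaussianRat ⟨0, 1⟩, ?_⟩
  rw [← map_pow, show (⟨0, 1⟩ : GaussianInt) ^ 2 = -1 by rw [pow_two]; rfl, map_neg, map_one]

theorem irreducible_pencilResolvent_genericSymm (g : ℕ) :
    Irreducible ((pencilResolvent (genericSymm (2 * g + 1) GaussianInt)).map
      (entryRingToField (2 * g + 1))) := by
  obtain ⟨J, hJ⟩ := exists_gaussianRat_sq_eq_neg_one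
  have : CharZero GaussianRat := inferInstance
  rw [entryRingToField, ← Polynomial.map_map, pencilResolvent_map, genericSymm_map_map,
    ← (pencilResolvent_monic _).irreducible_iff_irreducible_map_fraction_map]
  have h := irreducible_pencilResolvent_orthonormalPencil hJ g
  rw [← genericSymm_map_eval₂Hom (algebraMap GaussianRat (FractionRing (Polynomial GaussianRat)))
    (orthonormalPencil_transpose _ _), ← pencilResolvent_map] at h
  exact Polynomial.Monic.irreducible_of_irreducible_map _ _ (pencilResolvent_monic _) h

theorem mainTheorem4 (g : ℕ) :
    ∃ F : Polynomial (EntryRing (2 * g + 1)),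
      F.natDegree = 2 ^ (2 * g) ∧
      Irreducible (F.map (entryRingToField (2 * g + 1))) ∧
      ∀ B₀ : Matrix (Fin (2 * g + 1)) (Fin (2 * g + 1)) ℚ, IsDistinguished B₀ →
        ∃ q : ℚ, (specializeAt F B₀).IsRoot (q : GaussianRat) := by
  refine ⟨pencilResolvent (genericSymm (2 * g + 1) GaussianInt), ?_,
    irreducible_pencilResolvent_genericSymm g, ?_⟩
  · exact rootSignPoly_natDegree ⟨g, rfl⟩ _
  · intro B₀ hB₀
    obtain ⟨q, hq⟩ := hB₀.exists_root_pencilResolvent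
    refine ⟨q, ?_⟩
    have hs : (B₀.map (Rat.castHom GaussianRat))ᵀ = B₀.map (Rat.castHom GaussianRat) := by
      rw [← Matrix.transpose_map, hB₀.1]
    have h := genericSymm_map_eval₂Hom (algebraMap GaussianInt GaussianRat) hs
    have h2 : specializeAt (pencilResolvent (genericSymm (2 * g + 1) GaussianInt)) B₀ =
        (pencilResolvent B₀).map (Rat.castHom GaussianRat) := by
      rw [pencilResolvent_map, ← h, ← pencilResolvent_map, specializeAt]
      rfl
    rw [h2]
    exact hq.map (f := Rat.castHom GaussianRat)
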